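/- Let $K$ be a field of characteristic $0$. Let $E$ be the Grassmann algebra over $K$ with unit and with generators $e_1,e_2,\dots$, subject to $e_ie_j=-e_je_i$, and let $E_0$ and $E_1$ be the spans of the monomials of even and of odd length. Let $$R=M_{1,1}(E)=\left\{\begin{pmatrix}a&b\\c&d\end{pmatrix} : a,d\in E_0,\ b,c\in E_1\right\},$$ graded by $\mathbb{Z}_2$ so that $R_0$ consists of the diagonal matrices and $R_1$ of the matrices with zero diagonal, and endowed with the graded involution $$\begin{pmatrix}a&b\\c&d\end{pmatrix}^*=\begin{pmatrix}d&b\\-c&a\end{pmatrix}.$$ For $n_1,n_2,n_3,n_4\ge 0$ let $P_{n_1,n_2,n_3,n_4}$ be the space of multilinear polynomials, in the free unitary associative $K$-algebra, in $n_1$ symmetric variables of degree $0$, $n_2$ symmetric variables of degree $1$, $n_3$ skew-symmetric variables of degree $0$ and $n_4$ skew-symmetric variables of degree $1$. The group $S_{n_1}\times S_{n_2}\times S_{n_3}\times S_{n_4}$ acts on it by permuting the variables of each kind. Let $\mathrm{Id}(R)$ be the set of graded $*$-identities of $R$, that is, of the polynomials that vanish under every substitution of elements of $R$ of the corresponding degree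 and symmetry. The $(n_1,n_2,n_3,n_4)$-th cocharacter $\chi_{n_1,n_2,n_3,n_4}(R)$ is the character of the module $P_{n_1,n_2,n_3,n_4}/(P_{n_1,n_2,n_3,n_4}\cap \mathrm{Id}(R))$. For a partition $\lambda\vdash n$ let $\chi_\lambda$ be the irreducible character of $S_n$ attached to $\lambda$. Theorem. A family of non-negative integers $m_{\langle\lambda\rangle}$, indexed by all multipartitions $\langle\lambda\rangle=(\lambda(1),\lambda(2),\lambda(3),\lambda(4))$, satisfies $$\chi_{n_1,n_2,n_3,n_4}(R)=\sum_{\lambda(1)\vdash n_1,\dots,\lambda(4)\vdash n_4} m_{\langle\lambda\rangle}\,\chi_{\lambda(1)}\otimes\chi_{\lambda(2)}\otimes\chi_{\lambda(3)}\otimes\chi_{\lambda(4)}\qquad\text{for all } n_1,n_2,n_3,n_4\ge 0$$ if and only if the following hold: 1. $m_{\langle\lambda\rangle}=1$ if $\langle\lambda\rangle=((n_1),\emptyset,(n_3),\emptyset)$ with $n_1,n_3\ge0$; 2. $m_{\langle\lambda\rangle}=2$ if $\langle\lambda\rangle=((n_1),(1^{n_2}),(n_3),(1^{n_2}))$ with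 $n_1,n_3\ge 0$ and $n_2\ge1$; 3. $m_{\langle\lambda\rangle}=1$ if $\langle\lambda\rangle=((n_1),(1^{n_2+1}),(n_3),(1^{n_2}))$ with $n_1,n_2,n_3\ge0$; 4. $m_{\langle\lambda\rangle}=1$ if $\langle\lambda\rangle=((n_1),(1^{n_2}),(n_3),(1^{n_2+1}))$ with $n_1,n_2,n_3\ge0$; 5. $m_{\langle\lambda\rangle}=0$ in all remaining cases. Here $(0)$ and $(1^0)$ denote the empty partition $\emptyset$. In particular, the multiplicities of the cocharacters of $R$ exist, are unique, and are given by 1--5. -/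

import Mathlib

noncomputable section

namespace GradedStar

/-! ## `ℤ₂`-graded algebras with graded involution and their identities -/

/-- A graded involution on a `ℤ₂`-graded algebra `A = 𝒜 0 ⊕ 𝒜 1`: a linear antiautomorphism of
order two which preserves the homogeneous components. -/
structure GradedInvolution {K A : Type*} [Field K] [Ring A] [Algebra K A]
    (𝒜 : ZMod 2 → Submodule K A) [GradedAlgebra 𝒜] where
  star : A →ₗ[K] A
  star_mul : ∀ a b, star (a * b) = star b * star a
  star_star : ∀ a, star (star a) = a
  star_mem : ∀ g a, a ∈ 𝒜 g → star a ∈ 𝒜 g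

/-- The free variables: `y0 i`, `y1 i` are the symmetric variables of degree `0` and `1`, and
`z0 i`, `z1 i` are the skew-symmetric variables of degree `0` and `1`. Indices start at `0`. -/
inductive Var : Type
  | y0 (i : ℕ)
  | y1 (i : ℕ)
  | z0 (i : ℕ)
  | z1 (i : ℕ)

/-- A substitution of elements of `A` for the variables that respects degree and symmetry. -/
structure Admissible {K A : Type*} [Field K] [Ring A] [Algebra K A]
    {𝒜 : ZMod 2 → Submodule K A} [GradedAlgebra 𝒜] (s : GradedInvolution 𝒜)
    (φ : Var → A) : Prop where
  y0 : ∀ i, φ (.y0 i) ∈ 𝒜 0 ∧ s.star (φ (.y0 i)) = φ (.y0 i)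
  y1 : ∀ i, φ (.y1 i) ∈ 𝒜 1 ∧ s.star (φ (.y1 i)) = φ (.y1 i)
  z0 : ∀ i, φ (.z0 i) ∈ 𝒜 0 ∧ s.star (φ (.z0 i)) = -φ (.z0 i)
  z1 : ∀ i, φ (.z1 i) ∈ 𝒜 1 ∧ s.star (φ (.z1 i)) = -φ (.z1 i)

/-- The graded `*`-polynomial identities of `A`, as a subspace of the free unitary algebra on
`Var`. -/
def identities {K A : Type*} [Field K] [Ring A] [Algebra K A]
    {𝒜 : ZMod 2 → Submodule K A} [GradedAlgebra 𝒜] (s : GradedInvolution 𝒜) :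
    Submodule K (FreeAlgebra K Var) where
  carrier := {f | ∀ φ : Var → A, Admissible s φ → FreeAlgebra.lift K φ f = 0}
  add_mem' hf hg φ hφ := by rw [map_add, hf φ hφ, hg φ hφ, add_zero]
  zero_mem' φ _ := map_zero _
  smul_mem' c f hf φ hφ := by rw [map_smul, hf φ hφ, smul_zero]

/-! ## Multilinear polynomials, the action of the symmetric groups, cocharacters -/

/-- The variables of `P_{n₁,n₂,n₃,n₄}`: the first `n₁` of the `y0 i`, the first `n₂` of the
`y1 i`, the first `n₃` of the `z0 i` and the first `n₄` of the `z1 i`. -/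
def Var.InRange (n₁ n₂ n₃ n₄ : ℕ) : Var → Prop
  | .y0 i => i < n₁
  | .y1 i => i < n₂
  | .z0 i => i < n₃
  | .z1 i => i < n₄

/-- The space `P_{n₁,n₂,n₃,n₄}` of multilinear polynomials: the span of the monomials in which
each variable in range occurs exactly once, and no other variable occurs. -/
def multilinear (K : Type*) [Field K] (n₁ n₂ n₃ n₄ : ℕ) : Submodule K (FreeAlgebra K Var) :=
  Submodule.span K {m | ∃ l : List Var, l.Nodup ∧ (∀ v, v ∈ l ↔ v.InRange n₁ n₂ n₃ n₄) ∧
    m = (l.map (FreeAlgebra.ι K)).prod}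

/-- `S_{n₁} × S_{n₂} × S_{n₃} × S_{n₄}`. -/
abbrev SymProd (n₁ n₂ n₃ n₄ : ℕ) : Type :=
  Equiv.Perm (Fin n₁) × Equiv.Perm (Fin n₂) × Equiv.Perm (Fin n₃) × Equiv.Perm (Fin n₄)

/-- A permutation of `{0, …, n - 1}`, extended to `ℕ` by fixing all `i ≥ n`. -/
def extendPerm (n : ℕ) : Equiv.Perm (Fin n) →* Equiv.Perm ℕ :=
  Equiv.Perm.extendDomainHom (Fin.equivSubtype (n := n))

/-- The renaming of the variables by a quadruple of permutations. -/
def renameVar {n₁ n₂ n₃ n₄ : ℕ} (g : SymProd n₁ n₂ n₃ n₄) : Var → Var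
  | .y0 i => .y0 (extendPerm n₁ g.1 i)
  | .y1 i => .y1 (extendPerm n₂ g.2.1 i)
  | .z0 i => .z0 (extendPerm n₃ g.2.2.1 i)
  | .z1 i => .z1 (extendPerm n₄ g.2.2.2 i)

/-- The left action of `S_{n₁} × S_{n₂} × S_{n₃} × S_{n₄}` on the free algebra by
renaming the variables. -/
def freeAction (K : Type*) [Field K] (n₁ n₂ n₃ n₄ : ℕ) :
    Representation K (SymProd n₁ n₂ n₃ n₄) (FreeAlgebra K Var) where
  toFun g := (FreeAlgebra.lift K (FreeAlgebra.ι K ∘ renameVar g)).toLinearMap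
  map_one' := by
    have : (FreeAlgebra.ι K ∘ renameVar (1 : SymProd n₁ n₂ n₃ n₄)) = FreeAlgebra.ι K := by
      funext v; cases v <;> simp [renameVar]
    rw [this, show FreeAlgebra.lift K (FreeAlgebra.ι K) = AlgHom.id K (FreeAlgebra K Var) by
      ext v; simp]
    rfl
  map_mul' g h := by
    rw [Module.End.mul_eq_comp, ← AlgHom.comp_toLinearMap]
    congr 1
    ext v
    cases v <;> simp [renameVar]

theorem extendPerm_lt {n : ℕ} (σ : Equiv.Perm (Fin n)) (i : ℕ) :
    extendPerm n σ i < n ↔ i < n := by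
  have key : ∀ (τ : Equiv.Perm (Fin n)) (j : ℕ), j < n → extendPerm n τ j < n := by
    intro τ j hj
    have := Equiv.Perm.extendDomain_apply_image τ (Fin.equivSubtype (n := n)) ⟨j, hj⟩
    simp only [Fin.equivSubtype_apply] at this
    simp only [extendPerm, Equiv.Perm.extendDomainHom_apply, this]
    exact (τ ⟨j, hj⟩).2
  refine ⟨fun h => ?_, key σ i⟩
  have := key σ⁻¹ _ h
  simpa using this

theorem renameVar_inRange {n₁ n₂ n₃ n₄ : ℕ} (g : SymProd n₁ n₂ n₃ n₄) (v : Var) :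
    (renameVar g v).InRange n₁ n₂ n₃ n₄ ↔ v.InRange n₁ n₂ n₃ n₄ := by
  cases v <;> simp [renameVar, Var.InRange, extendPerm_lt]

theorem renameVar_inv {n₁ n₂ n₃ n₄ : ℕ} (g : SymProd n₁ n₂ n₃ n₄) (v : Var) :
    renameVar g (renameVar g⁻¹ v) = v := by
  cases v <;> simp [renameVar]

theorem renameVar_injective {n₁ n₂ n₃ n₄ : ℕ} (g : SymProd n₁ n₂ n₃ n₄) :
    Function.Injective (renameVar g) := by
  refine Function.LeftInverse.injective (g := renameVar g⁻¹) fun v => ?_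
  simpa using renameVar_inv g⁻¹ v

theorem multilinear_le_comap (K : Type*) [Field K] (n₁ n₂ n₃ n₄ : ℕ) (g : SymProd n₁ n₂ n₃ n₄) :
    multilinear K n₁ n₂ n₃ n₄ ≤ (multilinear K n₁ n₂ n₃ n₄).comap (freeAction K n₁ n₂ n₃ n₄ g) := by
  refine Submodule.span_le.2 ?_
  rintro _ ⟨l, hl, hmem, rfl⟩
  refine Submodule.subset_span ⟨l.map (renameVar g), hl.map (renameVar_injective g), ?_, ?_⟩
  · intro v
    rw [List.mem_map]
    constructor
    · rintro ⟨w, hw, rfl⟩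
      exact (renameVar_inRange g w).2 ((hmem w).1 hw)
    · intro hv
      refine ⟨renameVar g⁻¹ v, (hmem _).2 ((renameVar_inRange g⁻¹ v).2 hv), renameVar_inv g v⟩
  · simp [freeAction, map_list_prod, Function.comp_def]

/-- The action on `P_{n₁,n₂,n₃,n₄}`. -/
def multilinearAction (K : Type*) [Field K] (n₁ n₂ n₃ n₄ : ℕ) :
    Representation K (SymProd n₁ n₂ n₃ n₄) (multilinear K n₁ n₂ n₃ n₄) :=
  (freeAction K n₁ n₂ n₃ n₄).subrepresentation (multilinear K n₁ n₂ n₃ n₄)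
    (multilinear_le_comap K n₁ n₂ n₃ n₄)

section Cocharacter

variable {K A : Type*} [Field K] [Ring A] [Algebra K A]
  {𝒜 : ZMod 2 → Submodule K A} [GradedAlgebra 𝒜]

/-- The multilinear identities `P_{n₁,n₂,n₃,n₄} ∩ Id(A)`, as a subspace of `P_{n₁,n₂,n₃,n₄}`. -/
def multilinearIdentities (s : GradedInvolution 𝒜) (n₁ n₂ n₃ n₄ : ℕ) :
    Submodule K (multilinear K n₁ n₂ n₃ n₄) :=
  (identities s).comap (multilinear K n₁ n₂ n₃ n₄).subtype

theorem Admissible.comp_renameVar {s : GradedInvolution 𝒜} {φ : Var → A} (hφ : Admissible s φ)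
    {n₁ n₂ n₃ n₄ : ℕ} (g : SymProd n₁ n₂ n₃ n₄) : Admissible s (φ ∘ renameVar g) :=
  ⟨fun _ => hφ.y0 _, fun _ => hφ.y1 _, fun _ => hφ.z0 _, fun _ => hφ.z1 _⟩

theorem multilinearIdentities_le_comap (s : GradedInvolution 𝒜) (n₁ n₂ n₃ n₄ : ℕ)
    (g : SymProd n₁ n₂ n₃ n₄) :
    multilinearIdentities s n₁ n₂ n₃ n₄ ≤
      (multilinearIdentities s n₁ n₂ n₃ n₄).comap (multilinearAction K n₁ n₂ n₃ n₄ g) := by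
  intro f hf φ hφ
  have h := hf (φ ∘ renameVar g) (hφ.comp_renameVar g)
  have e : FreeAlgebra.lift K (φ ∘ renameVar g) =
      (FreeAlgebra.lift K φ).comp (FreeAlgebra.lift K (FreeAlgebra.ι K ∘ renameVar g)) := by
    ext v; simp
  rw [e] at h
  exact h

/-- The action on `P_{n₁,n₂,n₃,n₄}(A) = P_{n₁,n₂,n₃,n₄} / (P_{n₁,n₂,n₃,n₄} ∩ Id(A))`. -/
def quotientAction (s : GradedInvolution 𝒜) (n₁ n₂ n₃ n₄ : ℕ) :
    Representation K (SymProd n₁ n₂ n₃ n₄)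
      (multilinear K n₁ n₂ n₃ n₄ ⧸ multilinearIdentities s n₁ n₂ n₃ n₄) :=
  (multilinearAction K n₁ n₂ n₃ n₄).quotient (multilinearIdentities s n₁ n₂ n₃ n₄)
    (multilinearIdentities_le_comap s n₁ n₂ n₃ n₄)

/-- The `(n₁,n₂,n₃,n₄)`-th cocharacter of `A`: the character of `P_{n₁,n₂,n₃,n₄}(A)`. -/
def cocharacter (s : GradedInvolution 𝒜) (n₁ n₂ n₃ n₄ : ℕ) : SymProd n₁ n₂ n₃ n₄ → K :=
  (quotientAction s n₁ n₂ n₃ n₄).character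

end Cocharacter

/-! ## The irreducible characters of the symmetric groups -/

/-- The (row, column) position of the entry `k` in the tableau whose rows have the given lengths
and which is filled with `0, 1, 2, …` row by row, from left to right and from top to bottom. -/
def cellOf : List ℕ → ℕ → ℕ × ℕ
  | [], k => (0, k)
  | a :: l, k => if k < a then (0, k) else ((cellOf l (k - a)).1 + 1, (cellOf l (k - a)).2)

/-- The position of the entry `k` in the standard tableau of shape `p` filled row by row. -/
def tableauCell {n : ℕ} (p : n.Partition) (k : Fin n) : ℕ × ℕ :=
  cellOf (p.parts.sort (· ≥ ·)) k

/-- The sum of all permutations that preserve every row of the tableau. -/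
def rowSymmetrizer (K : Type*) [Field K] {n : ℕ} (p : n.Partition) :
    MonoidAlgebra K (Equiv.Perm (Fin n)) :=
  ∑ σ : Equiv.Perm (Fin n) with ∀ k, (tableauCell p (σ k)).1 = (tableauCell p k).1,
    MonoidAlgebra.single σ 1

/-- The signed sum of all permutations that preserve every column of the tableau. -/
def columnAntisymmetrizer (K : Type*) [Field K] {n : ℕ} (p : n.Partition) :
    MonoidAlgebra K (Equiv.Perm (Fin n)) :=
  ∑ σ : Equiv.Perm (Fin n) with ∀ k, (tableauCell p (σ k)).2 = (tableauCell p k).2,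
    MonoidAlgebra.single σ ((Equiv.Perm.sign σ : ℤ) : K)

/-- The Young symmetrizer of the partition `p`. -/
def youngSymmetrizer (K : Type*) [Field K] {n : ℕ} (p : n.Partition) :
    MonoidAlgebra K (Equiv.Perm (Fin n)) :=
  rowSymmetrizer K p * columnAntisymmetrizer K p

/-- The Specht module of `p`, realised as the left ideal of the group algebra generated by the
Young symmetrizer. -/
def spechtModule (K : Type*) [Field K] {n : ℕ} (p : n.Partition) :
    Submodule K (MonoidAlgebra K (Equiv.Perm (Fin n))) :=
  LinearMap.range (LinearMap.mulRight K (youngSymmetrizer K p))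

/-- The left regular representation of `S_n` on its group algebra. -/
def regularAction (K : Type*) [Field K] (n : ℕ) :
    Representation K (Equiv.Perm (Fin n)) (MonoidAlgebra K (Equiv.Perm (Fin n))) where
  toFun g := LinearMap.mulLeft K (MonoidAlgebra.of K _ g)
  map_one' := by ext; simp
  map_mul' g h := by rw [map_mul, LinearMap.mulLeft_mul]; rfl

theorem spechtModule_le_comap (K : Type*) [Field K] {n : ℕ} (p : n.Partition)
    (g : Equiv.Perm (Fin n)) :
    spechtModule K p ≤ (spechtModule K p).comap (regularAction K n g) := by
  rintro _ ⟨x, rfl⟩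
  exact ⟨MonoidAlgebra.of K _ g * x, mul_assoc _ _ _⟩

/-- The irreducible representation of `S_n` attached to the partition `p`. -/
def spechtRep (K : Type*) [Field K] {n : ℕ} (p : n.Partition) :
    Representation K (Equiv.Perm (Fin n)) (spechtModule K p) :=
  (regularAction K n).subrepresentation (spechtModule K p) (spechtModule_le_comap K p)

/-- The irreducible character `χ_p` of `S_n`. -/
def irrChar (K : Type*) [Field K] {n : ℕ} (p : n.Partition) : Equiv.Perm (Fin n) → K :=
  (spechtRep K p).character

/-- The one-row partition `(n)`; it is the empty partition for `n = 0`. -/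
def oneRow (n : ℕ) : n.Partition := Nat.Partition.indiscrete n

/-- The one-column partition `(1ⁿ)`; it is the empty partition for `n = 0`. -/
def oneColumn (n : ℕ) : n.Partition := Nat.Partition.ofSums n (Multiset.replicate n 1) (by simp)

/-- A family of natural numbers indexed by all multipartitions
`⟨λ⟩ = (λ(1), λ(2), λ(3), λ(4))`, with `λ(i) ⊢ nᵢ`. -/
abbrev MultiplicityFamily : Type :=
  ∀ n₁ n₂ n₃ n₄ : ℕ, n₁.Partition → n₂.Partition → n₃.Partition → n₄.Partition → ℕ

/-- `m` gives the multiplicities of the cocharacters of `A`: for all `n₁, n₂, n₃, n₄`,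
`χ_{n₁,n₂,n₃,n₄}(A) = ∑ m_{⟨λ⟩} χ_{λ(1)} ⊗ χ_{λ(2)} ⊗ χ_{λ(3)} ⊗ χ_{λ(4)}`. -/
def IsCocharacterMultiplicity {K A : Type*} [Field K] [Ring A] [Algebra K A]
    {𝒜 : ZMod 2 → Submodule K A} [GradedAlgebra 𝒜] (s : GradedInvolution 𝒜)
    (m : MultiplicityFamily) : Prop :=
  ∀ (n₁ n₂ n₃ n₄ : ℕ) (g : SymProd n₁ n₂ n₃ n₄),
    cocharacter s n₁ n₂ n₃ n₄ g =
      ∑ p₁ : n₁.Partition, ∑ p₂ : n₂.Partition, ∑ p₃ : n₃.Partition, ∑ p₄ : n₄.Partition,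
        (m n₁ n₂ n₃ n₄ p₁ p₂ p₃ p₄ : K) *
          (irrChar K p₁ g.1 * irrChar K p₂ g.2.1 * irrChar K p₃ g.2.2.1 * irrChar K p₄ g.2.2.2)

/-! ## The algebra `M_{1,1}(E)` and its involution -/

/-- The Grassmann algebra `E` on generators `e₀, e₁, e₂, …`. -/
abbrev Grassmann (K : Type*) [Field K] : Type _ := ExteriorAlgebra K (ℕ →₀ K)

/-- The components `E₀` and `E₁` of `E`, spanned by the monomials of even and odd length. -/
def grassmannPart (K : Type*) [Field K] (i : ZMod 2) : Submodule K (Grassmann K) :=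
  CliffordAlgebra.evenOdd (0 : QuadraticForm K (ℕ →₀ K)) i

section M11

variable (K : Type*) [Field K]

variable {K} in
theorem grassmannPart_mul {i j k : ZMod 2} (h : i + j = k) {a b : Grassmann K}
    (ha : a ∈ grassmannPart K i) (hb : b ∈ grassmannPart K j) : a * b ∈ grassmannPart K k :=
  h ▸ CliffordAlgebra.evenOdd_mul_le _ i j (Submodule.mul_mem_mul ha hb)

variable {K} in
theorem grassmann_comm {i : ZMod 2} {a b : Grassmann K}
    (ha : a ∈ grassmannPart K 0) (hb : b ∈ grassmannPart K i) : a * b = b * a := by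
  have := CliffordAlgebra.commute_map_mul_map_of_isOrtho_of_mem_evenOdd_zero_left
    (QuadraticMap.Isometry.id (0 : QuadraticForm K (ℕ →₀ K))) (QuadraticMap.Isometry.id _)
    (fun x y => by simp [QuadraticMap.IsOrtho]) _ _ ha hb
  simpa using this.eq

variable {K} in
theorem grassmann_anticomm {a b : Grassmann K}
    (ha : a ∈ grassmannPart K 1) (hb : b ∈ grassmannPart K 1) : a * b = -(b * a) := by
  have := CliffordAlgebra.map_mul_map_eq_neg_of_isOrtho_of_mem_evenOdd_one
    (QuadraticMap.Isometry.id (0 : QuadraticForm K (ℕ →₀ K))) (QuadraticMap.Isometry.id _)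
    (fun x y => by simp [QuadraticMap.IsOrtho]) _ _ ha hb
  simpa using this

/-- `M_{1,1}(E)`: the `2 × 2` matrices with diagonal entries in `E₀` and off-diagonal entries
in `E₁`. -/
def M11 : Subalgebra K (Matrix (Fin 2) (Fin 2) (Grassmann K)) where
  carrier := {M | M 0 0 ∈ grassmannPart K 0 ∧ M 1 1 ∈ grassmannPart K 0 ∧
    M 0 1 ∈ grassmannPart K 1 ∧ M 1 0 ∈ grassmannPart K 1}
  add_mem' := fun ⟨a, b, c, d⟩ ⟨a', b', c', d'⟩ =>
    ⟨add_mem a a', add_mem b b', add_mem c c', add_mem d d'⟩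
  mul_mem' := by
    rintro M N ⟨a, b, c, d⟩ ⟨a', b', c', d'⟩
    simp only [Set.mem_ofPred_eq, Matrix.mul_apply, Fin.sum_univ_two]
    exact ⟨add_mem (grassmannPart_mul (by decide) a a') (grassmannPart_mul (by decide) c d'),
      add_mem (grassmannPart_mul (by decide) d c') (grassmannPart_mul (by decide) b b'),
      add_mem (grassmannPart_mul (by decide) a c') (grassmannPart_mul (by decide) c b'),
      add_mem (grassmannPart_mul (by decide) d a') (grassmannPart_mul (by decide) b d')⟩
  algebraMap_mem' r := by
    have h : algebraMap K (Grassmann K) r ∈ grassmannPart K 0 :=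
      CliffordAlgebra.one_le_evenOdd_zero _ (Submodule.algebraMap_mem r)
    simp [Matrix.algebraMap_matrix_apply, h]

/-- The natural grading of `M_{1,1}(E)`: the diagonal matrices have degree `0`, the matrices with
zero diagonal have degree `1`. -/
def M11.grading (i : ZMod 2) : Submodule K (M11 K) where
  carrier := {M | (i = 0 → M.1 0 1 = 0 ∧ M.1 1 0 = 0) ∧ (i = 1 → M.1 0 0 = 0 ∧ M.1 1 1 = 0)}
  add_mem' := by
    rintro M N ⟨h₀, h₁⟩ ⟨h₀', h₁'⟩
    exact ⟨fun h => by simp [h₀ h, h₀' h], fun h => by simp [h₁ h, h₁' h]⟩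
  zero_mem' := by simp
  smul_mem' := by
    rintro c M ⟨h₀, h₁⟩
    exact ⟨fun h => by simp [h₀ h], fun h => by simp [h₁ h]⟩

/-- The diagonal part of a matrix in `M_{1,1}(E)`. -/
def M11.diagPart : M11 K →ₗ[K] M11.grading K 0 where
  toFun M := ⟨⟨!![M.1 0 0, 0; 0, M.1 1 1], by
    simpa [M11] using ⟨M.2.1, M.2.2.1⟩⟩, by simp [M11.grading]⟩
  map_add' M N := by
    ext i j; fin_cases i <;> fin_cases j <;> simp
  map_smul' c M := by
    ext i j; fin_cases i <;> fin_cases j <;> simp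

/-- The off-diagonal part of a matrix in `M_{1,1}(E)`. -/
def M11.offDiagPart : M11 K →ₗ[K] M11.grading K 1 where
  toFun M := ⟨⟨!![0, M.1 0 1; M.1 1 0, 0], by
    simpa [M11] using ⟨M.2.2.2.1, M.2.2.2.2⟩⟩, by simp [M11.grading]⟩
  map_add' M N := by
    ext i j; fin_cases i <;> fin_cases j <;> simp
  map_smul' c M := by
    ext i j; fin_cases i <;> fin_cases j <;> simp

instance M11.gradedAlgebra : GradedAlgebra (M11.grading K) where
  one_mem := by simp [M11.grading]
  mul_mem := by
    rintro i j M N ⟨h₀, h₁⟩ ⟨h₀', h₁'⟩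
    have hz : ∀ k : ZMod 2, k = 0 ∨ k = 1 := by decide
    rcases hz i with rfl | rfl <;> rcases hz j with rfl | rfl <;>
      simp_all [M11.grading, Matrix.mul_apply, Fin.sum_univ_two,
        show (1 : ZMod 2) + 1 = 0 from by decide]
  toDecomposition := DirectSum.Decomposition.ofLinearMap _
    ((DirectSum.lof K (ZMod 2) (fun i => M11.grading K i) 0) ∘ₗ M11.diagPart K +
      (DirectSum.lof K (ZMod 2) (fun i => M11.grading K i) 1) ∘ₗ M11.offDiagPart K)
    (by
      ext M i j
      fin_cases i <;> fin_cases j <;> simp [M11.diagPart, M11.offDiagPart])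
    (by
      have hz : ∀ k : ZMod 2, k = 0 ∨ k = 1 := by decide
      apply DirectSum.linearMap_ext
      intro i
      ext1 ⟨M, h₀, h₁⟩
      rcases hz i with rfl | rfl
      · have e₁ : M11.diagPart K M = ⟨M, h₀, h₁⟩ := by
          ext i j; fin_cases i <;> fin_cases j <;> simp [M11.diagPart, h₀ rfl]
        have e₂ : M11.offDiagPart K M = 0 := by
          ext i j; fin_cases i <;> fin_cases j <;> simp [M11.offDiagPart, h₀ rfl]
        simp [e₁, e₂]
      · have e₁ : M11.offDiagPart K M = ⟨M, h₀, h₁⟩ := by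
          ext i j; fin_cases i <;> fin_cases j <;> simp [M11.offDiagPart, h₁ rfl]
        have e₂ : M11.diagPart K M = 0 := by
          ext i j; fin_cases i <;> fin_cases j <;> simp [M11.diagPart, h₁ rfl]
        simp [e₁, e₂])

/-- The linear map `(a, b; c, d)* = (d, b; -c, a)` on `2 × 2` matrices. -/
def matrixStar (E : Type*) [Ring E] [Algebra K E] :
    Matrix (Fin 2) (Fin 2) E →ₗ[K] Matrix (Fin 2) (Fin 2) E where
  toFun M := !![M 1 1, M 0 1; -M 1 0, M 0 0]
  map_add' M N := by
    ext i j; fin_cases i <;> fin_cases j <;> simp [add_comm]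
  map_smul' c M := by
    ext i j; fin_cases i <;> fin_cases j <;> simp

/-- The linear map `(a, b; c, d)* = (d, b; -c, a)` of `M_{1,1}(E)`. -/
def M11.star : M11 K →ₗ[K] M11 K :=
  ((matrixStar K (Grassmann K)) ∘ₗ (M11 K).val.toLinearMap).codRestrict
    (Subalgebra.toSubmodule (M11 K)) fun M =>
      ⟨M.2.2.1, M.2.1, M.2.2.2.1, (grassmannPart K 1).neg_mem M.2.2.2.2⟩

theorem M11.coe_star (M : M11 K) :
    (M11.star K M : Matrix (Fin 2) (Fin 2) (Grassmann K)) =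
      !![M.1 1 1, M.1 0 1; -M.1 1 0, M.1 0 0] := rfl

theorem matrix_star_mul {E : Type*} [Ring E] (M N : Matrix (Fin 2) (Fin 2) E)
    (h₁ : N 1 0 * M 0 1 = -(M 0 1 * N 1 0)) (h₂ : M 1 0 * N 0 1 = -(N 0 1 * M 1 0))
    (h₃ : M 1 1 * N 1 1 = N 1 1 * M 1 1) (h₄ : M 0 0 * N 0 0 = N 0 0 * M 0 0)
    (h₅ : M 0 0 * N 0 1 = N 0 1 * M 0 0) (h₆ : N 1 1 * M 0 1 = M 0 1 * N 1 1)
    (h₇ : N 0 0 * M 1 0 = M 1 0 * N 0 0) (h₈ : M 1 1 * N 1 0 = N 1 0 * M 1 1) :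
    !![(M * N) 1 1, (M * N) 0 1; -(M * N) 1 0, (M * N) 0 0] =
      !![N 1 1, N 0 1; -N 1 0, N 0 0] * !![M 1 1, M 0 1; -M 1 0, M 0 0] := by
  ext i j
  fin_cases i <;> fin_cases j <;> simp [Matrix.mul_apply, Fin.sum_univ_two, *, add_comm]

theorem M11.star_mul (M N : M11 K) : M11.star K (M * N) = M11.star K N * M11.star K M := by
  obtain ⟨M, a, b, c, d⟩ := M
  obtain ⟨N, a', b', c', d'⟩ := N
  exact Subtype.ext (matrix_star_mul M N (grassmann_anticomm d' c) (grassmann_anticomm d c')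
    (grassmann_comm b b') (grassmann_comm a a') (grassmann_comm a c') (grassmann_comm b' c)
    (grassmann_comm a' d) (grassmann_comm b d'))

/-- The graded involution `(a, b; c, d)* = (d, b; -c, a)` of `M_{1,1}(E)`. -/
def M11.involution : GradedInvolution (M11.grading K) where
  star := M11.star K
  star_mul := M11.star_mul K
  star_star M := by
    ext i j; fin_cases i <;> fin_cases j <;> simp [M11.coe_star]
  star_mem := by
    rintro g M ⟨h₀, h₁⟩
    exact ⟨fun h => by simp [M11.coe_star, h₀ h], fun h => by simp [M11.coe_star, h₁ h]⟩

end M11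

end GradedStar

end

/-!
The argument has two independent halves.

*Values of words.* In `M_{1,1}(E)` the symmetric and skew-symmetric elements of degree `0` are the
multiples of `1` and of `e₁₁ - e₂₂` by elements of `E₀`, those of degree `1` are the multiples of
`e₁₂` and of `e₂₁` by elements of `E₁` (`Admissible.exists_coefficients`). The value of a word
is therefore the product of the Grassmann coefficients times the product of scalar matrices
(`lift_word`). Reordering the Grassmann factors costs a sign which depends on the word only
(`exists_sign_of_perm`), so every value of a multilinear polynomial `f` is `X A`, where `X` is the
product of the coefficients in a fixed order and the scalar matrix `A` depends on `f` only
(`exists_lift_eq_scaled`). Since `X ≠ 0` for suitable coefficients, `P / (P ∩ Id)` is isomorphic to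
the span of the products of the scalar matrices along the multilinear words
(`nonempty_quotient_equiv`). The symmetric groups only permute the factors of `X`, hence act by
`1 ⊗ sgn ⊗ 1 ⊗ sgn` (`quotientAction_eq`). As `e₁₂² = e₂₁² = 0`, the letters of degree `1` must
alternate, and the dimension of the span is `2`, `1` or `0` as stated (`finrank_unitSpan_zero` and
the lemmas after it).

*Uniqueness of the multiplicities.* The cocharacter is `d (1 ⊗ sgn ⊗ 1 ⊗ sgn)`, and its factors
are the irreducible characters of `(n)` and `(1ⁿ)`. No full orthogonality theory is needed: if
`p ≠ (n)`, some column of the tableau of `p` has two entries, so `∑ σ` annihilates the Young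
symmetrizer and `χ_p` is orthogonal to the trivial character; dually `χ_p` is orthogonal to
the sign if `p ≠ (1ⁿ)`. Pairing with `1 ⊗ sgn ⊗ 1 ⊗ sgn` thus determines one multiplicity, and
comparing values at the identity, which are positive, forces the others to vanish because they are
natural numbers (`smul_eq_sum_iff`).
-/

noncomputable section

namespace GradedStar

/-! ### Characters of the symmetric groups -/

section Symmetric

open Equiv

theorem cellOf_injective (l : List ℕ) : Function.Injective (cellOf l) := by
  induction l with
  | nil => intro a b h; simpa [cellOf] using h
  | cons a l ih =>
    intro b c h
    by_cases hb : b < a <;> by_cases hc : c < a <;> simp [cellOf, hb, hc] at h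
    · exact h
    · have := ih (Prod.ext h.1 h.2)
      omega

theorem tableauCell_injective {n : ℕ} (p : n.Partition) : Function.Injective (tableauCell p) :=
  fun _ _ h => Fin.ext (cellOf_injective _ h)

theorem tableauCell_oneRow {n : ℕ} (k : Fin n) : tableauCell (oneRow n) k = (0, (k : ℕ)) := by
  have hn : n ≠ 0 := fun h => absurd k.2 (by omega)
  simp [tableauCell, oneRow, Nat.Partition.indiscrete_parts hn, cellOf]

theorem cellOf_replicate_one (n k : ℕ) (h : k < n) : cellOf (List.replicate n 1) k = (k, 0) := by
  induction n generalizing k with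
  | zero => omega
  | succ n ih =>
    rcases k with _ | k
    · simp [List.replicate_succ, cellOf]
    · simp [List.replicate_succ, cellOf, ih k (by omega)]

theorem sort_replicate_one (n : ℕ) :
    (Multiset.replicate n 1).sort (· ≥ ·) = List.replicate n 1 := by
  rw [List.eq_replicate_iff]
  exact ⟨by simp, fun b hb => Multiset.eq_of_mem_replicate ((Multiset.mem_sort _).1 hb)⟩

theorem parts_oneColumn (n : ℕ) : (oneColumn n).parts = Multiset.replicate n 1 := by
  rw [oneColumn, Nat.Partition.ofSums_parts, Multiset.filter_eq_self]
  intro a ha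
  simp [Multiset.eq_of_mem_replicate ha]

theorem tableauCell_oneColumn {n : ℕ} (k : Fin n) :
    tableauCell (oneColumn n) k = ((k : ℕ), 0) := by
  rw [tableauCell, parts_oneColumn, sort_replicate_one, cellOf_replicate_one _ _ k.2]

/-- If `p` is not `(n)`, the first column of its tableau contains the first entries of the first
two rows. -/
theorem exists_same_column {n : ℕ} {p : n.Partition} (hp : p ≠ oneRow n) :
    ∃ i j, i ≠ j ∧ (tableauCell p i).2 = (tableauCell p j).2 := by
  have hsum : (p.parts.sort (· ≥ ·)).sum = n := by
    rw [← Multiset.sum_coe, Multiset.sort_eq, p.parts_sum]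
  have hpos : ∀ a ∈ p.parts.sort (· ≥ ·), 0 < a :=
    fun a ha => p.parts_pos ((Multiset.mem_sort _).1 ha)
  have hparts := Multiset.sort_eq p.parts (· ≥ ·)
  simp only [tableauCell]
  rcases hl : p.parts.sort (· ≥ ·) with _ | ⟨a, _ | ⟨b, l⟩⟩
  · refine absurd ?_ hp
    rw [hl] at hsum hparts
    obtain rfl : n = 0 := by simpa using hsum.symm
    exact Subsingleton.elim _ _
  · refine absurd ?_ hp
    rw [hl] at hsum hparts
    obtain rfl : a = n := by simpa using hsum
    have ha : a ≠ 0 := (hpos a (by simp [hl])).ne'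
    refine Nat.Partition.ext ?_
    rw [oneRow, Nat.Partition.indiscrete_parts ha, ← hparts]
    rfl
  · rw [hl] at hsum
    have ha : 0 < a := hpos a (by simp [hl])
    have hb : 0 < b := hpos b (by simp [hl])
    simp only [List.sum_cons] at hsum
    refine ⟨⟨0, by omega⟩, ⟨a, by omega⟩, by simp [Fin.ext_iff]; omega, ?_⟩
    simp [cellOf, ha, hb]

/-- If `p` is not `(1ⁿ)`, its longest row, which is the first one, has at least two entries. -/
theorem exists_same_row {n : ℕ} {p : n.Partition} (hp : p ≠ oneColumn n) :
    ∃ i j, i ≠ j ∧ (tableauCell p i).1 = (tableauCell p j).1 := by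
  have hsum : (p.parts.sort (· ≥ ·)).sum = n := by
    rw [← Multiset.sum_coe, Multiset.sort_eq, p.parts_sum]
  have hpos : ∀ a ∈ p.parts, 0 < a := fun a ha => p.parts_pos ha
  have hsort := Multiset.pairwise_sort p.parts (· ≥ ·)
  have hmem : ∀ a, a ∈ p.parts.sort (· ≥ ·) ↔ a ∈ p.parts := fun a => Multiset.mem_sort _
  simp only [tableauCell]
  by_cases h1 : ∀ a ∈ p.parts, a = 1
  · refine absurd (Nat.Partition.ext ?_) hp
    have h2 := Multiset.eq_replicate_card.2 h1
    have h3 := p.parts_sum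
    rw [h2, Multiset.sum_replicate, smul_eq_mul, mul_one] at h3
    rw [parts_oneColumn]
    exact h2.trans (by rw [h3])
  · push Not at h1
    obtain ⟨b, hb, hb1⟩ := h1
    have hb0 := hpos b hb
    rw [← hmem] at hb
    rcases hl : p.parts.sort (· ≥ ·) with _ | ⟨a, l⟩
    · simp [hl] at hb
    · rw [hl] at hsum hb hsort
      have hab : b ≤ a := by
        rcases List.mem_cons.1 hb with rfl | hb
        · exact le_rfl
        · exact (List.pairwise_cons.1 hsort).1 b hb
      simp only [List.sum_cons] at hsum
      refine ⟨⟨0, by omega⟩, ⟨1, by omega⟩, by simp [Fin.ext_iff], ?_⟩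
      simp [cellOf, show 0 < a by omega, show 1 < a by omega]

variable (K : Type*) [Field K]

/-- The sum `∑ χ(g) g` in the group algebra, for a character `χ` with values `±1`. Up to a scalar
it is the idempotent of the one-dimensional representation `χ`. -/
def signedSum {G : Type*} [Group G] [Fintype G] (χ : G →* ℤˣ) : MonoidAlgebra K G :=
  ∑ g, MonoidAlgebra.single g ((χ g : ℤ) : K)

variable {K}

theorem intCast_units_mul_self (u : ℤˣ) : ((u : ℤ) : K) * ((u : ℤ) : K) = 1 := by
  rw [← Int.cast_mul, ← Units.val_mul, Int.units_mul_self]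
  simp

section

variable {G : Type*} [Group G] [Fintype G] (χ : G →* ℤˣ)

theorem signedSum_mul_single (g : G) (c : K) :
    signedSum K χ * MonoidAlgebra.single g c = (((χ g : ℤ) : K) * c) • signedSum K χ := by
  rw [signedSum, Finset.sum_mul, Finset.smul_sum]
  refine Fintype.sum_equiv (Equiv.mulRight g) _ _ fun h => ?_
  rw [MonoidAlgebra.single_mul_single, MonoidAlgebra.smul_single, Equiv.coe_mulRight, map_mul]
  congr 1
  push_cast
  rw [smul_eq_mul]
  linear_combination (-((χ h : ℤ) : K) * c) * intCast_units_mul_self (K := K) (χ g)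

theorem single_mul_signedSum (g : G) (c : K) :
    MonoidAlgebra.single g c * signedSum K χ = (((χ g : ℤ) : K) * c) • signedSum K χ := by
  rw [signedSum, Finset.mul_sum, Finset.smul_sum]
  refine Fintype.sum_equiv (Equiv.mulLeft g) _ _ fun h => ?_
  rw [MonoidAlgebra.single_mul_single, MonoidAlgebra.smul_single, Equiv.coe_mulLeft, map_mul]
  congr 1
  push_cast
  rw [smul_eq_mul]
  linear_combination (-((χ h : ℤ) : K) * c) * intCast_units_mul_self (K := K) (χ g)

theorem exists_signedSum_mul (x : MonoidAlgebra K G) :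
    ∃ c : K, signedSum K χ * x = c • signedSum K χ := by
  induction x using MonoidAlgebra.induction_linear with
  | zero => exact ⟨0, by simp⟩
  | add x y hx hy =>
    obtain ⟨a, ha⟩ := hx
    obtain ⟨b, hb⟩ := hy
    exact ⟨a + b, by rw [mul_add, ha, hb, add_smul]⟩
  | single g c => exact ⟨_, signedSum_mul_single χ g c⟩

theorem exists_mul_signedSum (x : MonoidAlgebra K G) :
    ∃ c : K, x * signedSum K χ = c • signedSum K χ := by
  induction x using MonoidAlgebra.induction_linear with
  | zero => exact ⟨0, by simp⟩
  | add x y hx hy =>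
    obtain ⟨a, ha⟩ := hx
    obtain ⟨b, hb⟩ := hy
    exact ⟨a + b, by rw [add_mul, ha, hb, add_smul]⟩
  | single g c => exact ⟨_, single_mul_signedSum χ g c⟩

theorem signedSum_ne_zero : signedSum K χ ≠ 0 := by
  classical
  intro h
  have h1 := congrArg (fun f : MonoidAlgebra K G => f.coeff 1) h
  simp only [signedSum, MonoidAlgebra.coeff_sum, Finset.sum_apply', MonoidAlgebra.coeff_single,
    Finsupp.single_apply, MonoidAlgebra.coeff_zero, Finsupp.zero_apply] at h1
  simp at h1

end

/-- Multiplication by the transposition `(i j)` is a sign-reversing bijection of the stabilizer. -/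
theorem sum_sign_eq_zero [CharZero K] {n : ℕ} {α : Type*} [DecidableEq α] (f : Fin n → α)
    {i j : Fin n} (hij : i ≠ j) (h : f i = f j) :
    ∑ σ : Perm (Fin n) with ∀ k, f (σ k) = f k, ((Perm.sign σ : ℤ) : K) = 0 := by
  have hs : ∀ k, f (swap i j k) = f k := by
    intro k
    rw [swap_apply_def]
    split_ifs with h1 h2
    · rw [h1, h]
    · rw [h2, h]
    · rfl
  have key : ∑ σ : Perm (Fin n) with ∀ k, f (σ k) = f k, ((Perm.sign σ : ℤ) : K) =
      ∑ σ : Perm (Fin n) with ∀ k, f (σ k) = f k, -((Perm.sign σ : ℤ) : K) := by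
    refine Finset.sum_equiv (Equiv.mulLeft (swap i j)) (fun σ => ?_) fun σ _ => ?_
    · simp [hs]
    · simp [Perm.sign_swap hij]
  rw [Finset.sum_neg_distrib] at key
  exact self_eq_neg.1 key

theorem signedSum_one_mul_youngSymmetrizer [CharZero K] {n : ℕ} {p : n.Partition}
    (hp : p ≠ oneRow n) : signedSum K (1 : Perm (Fin n) →* ℤˣ) * youngSymmetrizer K p = 0 := by
  obtain ⟨i, j, hij, h⟩ := exists_same_column hp
  obtain ⟨c, hc⟩ := exists_signedSum_mul (1 : Perm (Fin n) →* ℤˣ) (rowSymmetrizer K p)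
  rw [youngSymmetrizer, ← mul_assoc, hc, smul_mul_assoc, columnAntisymmetrizer, Finset.mul_sum]
  simp only [signedSum_mul_single, MonoidHom.one_apply, Units.val_one, Int.cast_one, one_mul]
  rw [← Finset.sum_smul, sum_sign_eq_zero (fun k => (tableauCell p k).2) hij h, zero_smul,
    smul_zero]

theorem signedSum_sign_mul_youngSymmetrizer [CharZero K] {n : ℕ} {p : n.Partition}
    (hp : p ≠ oneColumn n) :
    signedSum K (Perm.sign : Perm (Fin n) →* ℤˣ) * youngSymmetrizer K p = 0 := by
  obtain ⟨i, j, hij, h⟩ := exists_same_row hp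
  rw [youngSymmetrizer, ← mul_assoc, rowSymmetrizer, Finset.mul_sum]
  simp only [signedSum_mul_single, mul_one]
  rw [← Finset.sum_smul, sum_sign_eq_zero (fun k => (tableauCell p k).1) hij h, zero_smul,
    zero_mul]

/-- If `∑ χ(g) g` annihilates the Young symmetrizer, then it acts as zero on the Specht module, so
the irreducible character is orthogonal to `χ`. -/
theorem sum_mul_irrChar_eq_zero {n : ℕ} {p : n.Partition} (χ : Perm (Fin n) →* ℤˣ)
    (h : signedSum K χ * youngSymmetrizer K p = 0) :
    ∑ σ, ((χ σ : ℤ) : K) * irrChar K p σ = 0 := by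
  have key : ∑ σ, ((χ σ : ℤ) : K) • spechtRep K p σ = 0 := by
    ext1 ⟨v, x, hx⟩
    refine Subtype.ext ?_
    obtain ⟨c, hc⟩ := exists_signedSum_mul χ x
    have : ∑ σ, ((χ σ : ℤ) : K) • (MonoidAlgebra.of K _ σ * v) = signedSum K χ * v := by
      simp [signedSum, Finset.sum_mul, ← smul_mul_assoc]
    have hv : v = x * youngSymmetrizer K p := hx.symm
    simp only [LinearMap.sum_apply, LinearMap.smul_apply, Submodule.coe_sum, Submodule.coe_smul]
    refine this.trans (Eq.trans ?_ (ZeroMemClass.coe_zero (spechtModule K p)).symm)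
    rw [hv, ← mul_assoc, hc, smul_mul_assoc, h, smul_zero]
  have h2 := congrArg (LinearMap.trace K (spechtModule K p)) key
  simp only [map_sum, map_smul, map_zero, smul_eq_mul] at h2
  exact h2

/-- A permutation preserving both the rows and the columns is trivial, so the identity has
coefficient `1` in the Young symmetrizer. -/
theorem youngSymmetrizer_ne_zero {n : ℕ} (p : n.Partition) : youngSymmetrizer K p ≠ 0 := by
  intro h
  have h1 := congrArg (fun f : MonoidAlgebra K (Perm (Fin n)) => f.coeff 1) h
  simp only [youngSymmetrizer, rowSymmetrizer, columnAntisymmetrizer, Finset.sum_mul_sum,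
    MonoidAlgebra.single_mul_single, MonoidAlgebra.coeff_sum, Finset.sum_apply',
    MonoidAlgebra.coeff_single, Finsupp.single_apply, one_mul, MonoidAlgebra.coeff_zero,
    Finsupp.zero_apply] at h1
  rw [Finset.sum_eq_single 1, Finset.sum_eq_single 1] at h1
  · simp at h1
  · intro σ _ hσ
    simp [hσ]
  · simp
  · intro σ hσ hσ1
    refine Finset.sum_eq_zero fun τ hτ => if_neg fun hστ => hσ1 ?_
    simp only [Finset.mem_filter, Finset.mem_univ, true_and] at hσ hτ
    obtain rfl : τ = σ⁻¹ := eq_inv_of_mul_eq_one_right hστ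
    refine Equiv.ext fun k => tableauCell_injective p (Prod.ext (hσ k) ?_)
    have := hτ (σ k)
    simpa using this.symm
  · simp

theorem irrChar_one_pos {n : ℕ} (p : n.Partition) : ∃ d : ℕ, 0 < d ∧ irrChar K p 1 = d := by
  refine ⟨Module.finrank K (spechtModule K p), ?_, ?_⟩
  · rw [Module.finrank_pos_iff, Submodule.nontrivial_iff_ne_bot]
    exact fun h => youngSymmetrizer_ne_zero (K := K) p
      ((Submodule.mem_bot K).1 (h ▸ ⟨1, one_mul _⟩))
  · exact Representation.char_one _

/-- If the Young symmetrizer is `∑ χ(g) g`, then the Specht module is the line spanned by it, on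
which the group acts by `χ`. -/
theorem irrChar_eq_of_youngSymmetrizer {n : ℕ} {p : n.Partition} (χ : Perm (Fin n) →* ℤˣ)
    (h : youngSymmetrizer K p = signedSum K χ) (σ : Perm (Fin n)) :
    irrChar K p σ = ((χ σ : ℤ) : K) := by
  have hspan : spechtModule K p = Submodule.span K {signedSum K χ} := by
    refine le_antisymm ?_ ?_
    · rintro _ ⟨x, rfl⟩
      obtain ⟨c, hc⟩ := exists_mul_signedSum χ x
      rw [LinearMap.mulRight_apply, h, hc]
      exact Submodule.smul_mem _ _ (Submodule.mem_span_singleton_self _)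
    · rw [Submodule.span_singleton_le_iff_mem, ← h]
      exact ⟨1, one_mul _⟩
  have hσ : spechtRep K p σ = ((χ σ : ℤ) : K) • LinearMap.id := by
    ext1 ⟨v, x, hx⟩
    refine Subtype.ext ?_
    obtain ⟨c, hc⟩ := exists_mul_signedSum χ x
    have hv : v = c • signedSum K χ := by rw [← hc, ← h]; exact hx.symm
    change MonoidAlgebra.of K _ σ * v = ((χ σ : ℤ) : K) • v
    rw [hv, mul_smul_comm, MonoidAlgebra.of_apply, single_mul_signedSum, mul_one, smul_comm]
  rw [irrChar, Representation.character, hσ, map_smul, LinearMap.trace_id, hspan,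
    finrank_span_singleton (signedSum_ne_zero χ)]
  simp

theorem irrChar_oneRow {n : ℕ} (σ : Perm (Fin n)) : irrChar K (oneRow n) σ = 1 := by
  rw [irrChar_eq_of_youngSymmetrizer 1]
  · simp
  · have h : ∀ σ : Perm (Fin n), (∀ k, σ k = k) ↔ σ = 1 := fun σ =>
      (Equiv.ext_iff (g := (1 : Perm (Fin n)))).symm
    simp [youngSymmetrizer, rowSymmetrizer, columnAntisymmetrizer, tableauCell_oneRow, signedSum,
      Fin.val_inj, h, Finset.filter_eq', MonoidAlgebra.one_def.symm]

theorem irrChar_oneColumn {n : ℕ} (σ : Perm (Fin n)) :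
    irrChar K (oneColumn n) σ = ((Perm.sign σ : ℤ) : K) := by
  rw [irrChar_eq_of_youngSymmetrizer Perm.sign]
  have h : ∀ σ : Perm (Fin n), (∀ k, σ k = k) ↔ σ = 1 := fun σ =>
      (Equiv.ext_iff (g := (1 : Perm (Fin n)))).symm
  simp [youngSymmetrizer, rowSymmetrizer, columnAntisymmetrizer, tableauCell_oneColumn, signedSum,
    Fin.val_inj, h, Finset.filter_eq', MonoidAlgebra.one_def.symm]

theorem sum_irrChar_eq_zero [CharZero K] {n : ℕ} {p : n.Partition} (hp : p ≠ oneRow n) :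
    ∑ σ, irrChar K p σ = 0 := by
  simpa using sum_mul_irrChar_eq_zero 1 (signedSum_one_mul_youngSymmetrizer (K := K) hp)

theorem sum_sign_mul_irrChar_eq_zero [CharZero K] {n : ℕ} {p : n.Partition}
    (hp : p ≠ oneColumn n) : ∑ σ, ((Perm.sign σ : ℤ) : K) * irrChar K p σ = 0 :=
  sum_mul_irrChar_eq_zero Perm.sign (signedSum_sign_mul_youngSymmetrizer hp)

/-- Let `X p` be functions on a finite group with positive integral value at `1`, one of which,
`X p₀ = ε`, has values `±1` and is orthogonal to all others. Then a multiple of `ε` is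
a combination of the `X p` with coefficients in `ℕ` in the obvious way only: orthogonality
determines the coefficient of `X p₀`, and the value at `1` leaves no room for the others. -/
theorem smul_eq_sum_iff [CharZero K] {G ι : Type*} [Group G] [Fintype G] [Fintype ι]
    (X : ι → G → K) (ε : G → K) (p₀ : ι) (hε : ∀ g, ε g * ε g = 1) (h₀ : X p₀ = ε)
    (horth : ∀ p, p ≠ p₀ → ∑ g, ε g * X p g = 0)
    (hpos : ∀ p, ∃ d : ℕ, 0 < d ∧ X p 1 = d) (d : ℕ) (m : ι → ℕ) :
    (∀ g, (d : K) * ε g = ∑ p, (m p : K) * X p g) ↔ m p₀ = d ∧ ∀ p, p ≠ p₀ → m p = 0 := by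
  classical
  constructor
  · intro h
    have hm : m p₀ = d := by
      have h1 : ∑ g, ε g * ((d : K) * ε g) = ∑ g, ε g * ∑ p, (m p : K) * X p g := by
        simp_rw [h]
      have h2 : ∑ g, ε g * ((d : K) * ε g) = Fintype.card G * d := by
        simp_rw [mul_left_comm (ε _), hε]
        simp
      have h3 : ∑ g, ε g * ∑ p, (m p : K) * X p g = Fintype.card G * m p₀ := by
        simp_rw [Finset.mul_sum]
        rw [Finset.sum_comm, Finset.sum_eq_single p₀]
        · simp_rw [h₀, mul_left_comm (ε _), hε]
          simp
        · intro p _ hp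
          simp_rw [mul_left_comm (ε _), ← Finset.mul_sum, horth p hp, mul_zero]
        · simp
      rw [h2, h3] at h1
      have hc : (Fintype.card G : K) ≠ 0 := Nat.cast_ne_zero.2 Fintype.card_ne_zero
      exact (Nat.cast_injective (mul_left_cancel₀ hc h1)).symm
    refine ⟨hm, ?_⟩
    choose D hD hX using hpos
    have h1 : d * D p₀ = ∑ p, m p * D p := by
      have := h 1
      rw [← h₀] at this
      simp_rw [hX] at this
      exact_mod_cast this
    rw [← Finset.add_sum_erase _ _ (Finset.mem_univ p₀), hm, Nat.left_eq_add,
      Finset.sum_eq_zero_iff] at h1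
    intro p hp
    have := h1 p (Finset.mem_erase.2 ⟨hp, Finset.mem_univ p⟩)
    exact (Nat.mul_eq_zero.1 this).resolve_right (hD p).ne'
  · rintro ⟨hm, h⟩ g
    rw [Finset.sum_eq_single p₀, hm, h₀]
    · intro p _ hp
      simp [h p hp]
    · simp

/-- The multiple `d (1 ⊗ sgn ⊗ 1 ⊗ sgn)` is a combination of the irreducible characters with
coefficients in `ℕ` in the obvious way only. -/
theorem smul_sign_mul_sign_eq_sum_iff [CharZero K] {n₁ n₂ n₃ n₄ : ℕ} (d : ℕ)
    (m : n₁.Partition → n₂.Partition → n₃.Partition → n₄.Partition → ℕ) :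
    (∀ g : SymProd n₁ n₂ n₃ n₄,
      (d : K) * (((Perm.sign g.2.1 : ℤ) : K) * ((Perm.sign g.2.2.2 : ℤ) : K)) =
        ∑ p₁ : n₁.Partition, ∑ p₂ : n₂.Partition, ∑ p₃ : n₃.Partition, ∑ p₄ : n₄.Partition,
          (m p₁ p₂ p₃ p₄ : K) *
            (irrChar K p₁ g.1 * irrChar K p₂ g.2.1 * irrChar K p₃ g.2.2.1 *
              irrChar K p₄ g.2.2.2)) ↔
      m (oneRow n₁) (oneColumn n₂) (oneRow n₃) (oneColumn n₄) = d ∧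
        ∀ p₁ p₂ p₃ p₄, ¬ (p₁ = oneRow n₁ ∧ p₂ = oneColumn n₂ ∧ p₃ = oneRow n₃ ∧
          p₄ = oneColumn n₄) → m p₁ p₂ p₃ p₄ = 0 := by
  have key := smul_eq_sum_iff (K := K) (G := SymProd n₁ n₂ n₃ n₄)
    (ι := n₁.Partition × n₂.Partition × n₃.Partition × n₄.Partition)
    (fun p g => irrChar K p.1 g.1 * irrChar K p.2.1 g.2.1 * irrChar K p.2.2.1 g.2.2.1 *
      irrChar K p.2.2.2 g.2.2.2)
    (fun g => ((Perm.sign g.2.1 : ℤ) : K) * ((Perm.sign g.2.2.2 : ℤ) : K))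
    (oneRow n₁, oneColumn n₂, oneRow n₃, oneColumn n₄)
    (fun g => by
      linear_combination
        ((Perm.sign g.2.2.2 : ℤ) : K) ^ 2 * intCast_units_mul_self (K := K) (Perm.sign g.2.1) +
          intCast_units_mul_self (K := K) (Perm.sign g.2.2.2))
    (by
      funext g
      simp [irrChar_oneRow, irrChar_oneColumn])
    (by
      rintro ⟨p₁, p₂, p₃, p₄⟩ hp
      have hfactor : ∑ g : SymProd n₁ n₂ n₃ n₄,
          ((Perm.sign g.2.1 : ℤ) : K) * ((Perm.sign g.2.2.2 : ℤ) : K) *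
            (irrChar K p₁ g.1 * irrChar K p₂ g.2.1 * irrChar K p₃ g.2.2.1 *
              irrChar K p₄ g.2.2.2) =
          (∑ σ, irrChar K p₁ σ) * ((∑ σ, ((Perm.sign σ : ℤ) : K) * irrChar K p₂ σ) *
            ((∑ σ, irrChar K p₃ σ) * ∑ σ, ((Perm.sign σ : ℤ) : K) * irrChar K p₄ σ)) := by
        simp_rw [Fintype.sum_mul_sum, Finset.mul_sum, Fintype.sum_prod_type]
        refine Finset.sum_congr rfl fun _ _ => Finset.sum_congr rfl fun _ _ =>
          Finset.sum_congr rfl fun _ _ => Finset.sum_congr rfl fun _ _ => ?_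
        ring
      refine hfactor.trans ?_
      by_cases h₁ : p₁ = oneRow n₁
      · by_cases h₂ : p₂ = oneColumn n₂
        · by_cases h₃ : p₃ = oneRow n₃
          · have h₄ : p₄ ≠ oneColumn n₄ := fun h₄ => hp (by rw [h₁, h₂, h₃, h₄])
            simp [sum_sign_mul_irrChar_eq_zero h₄]
          · simp [sum_irrChar_eq_zero h₃]
        · simp [sum_sign_mul_irrChar_eq_zero h₂]
      · simp [sum_irrChar_eq_zero h₁])
    (by
      rintro ⟨p₁, p₂, p₃, p₄⟩
      obtain ⟨d₁, h₁, e₁⟩ := irrChar_one_pos (K := K) p₁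
      obtain ⟨d₂, h₂, e₂⟩ := irrChar_one_pos (K := K) p₂
      obtain ⟨d₃, h₃, e₃⟩ := irrChar_one_pos (K := K) p₃
      obtain ⟨d₄, h₄, e₄⟩ := irrChar_one_pos (K := K) p₄
      exact ⟨d₁ * d₂ * d₃ * d₄, by positivity, by simp [e₁, e₂, e₃, e₄]⟩)
    d (fun p => m p.1 p.2.1 p.2.2.1 p.2.2.2)
  simp only [Fintype.sum_prod_type, ne_eq, Prod.forall, Prod.mk.injEq] at key
  simpa only [Prod.forall] using key

end Symmetric

/-! ### Signs in the Grassmann algebra -/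

section Signs

variable {K : Type*} [Field K]

/-- Reordering a product of homogeneous elements of the Grassmann algebra multiplies it by a sign
which depends on the parities of the factors only. -/
theorem exists_sign_of_perm {α : Type*} (π : α → ZMod 2) {l l' : List α} (h : l.Perm l') :
    ∃ s : ℤˣ, ∀ x : α → Grassmann K, (∀ a, x a ∈ grassmannPart K (π a)) →
      (l.map x).prod = ((s : ℤ) : K) • (l'.map x).prod := by
  induction h with
  | nil => exact ⟨1, by simp⟩
  | cons a _ ih =>
    obtain ⟨s, hs⟩ := ih
    refine ⟨s, fun x hx => ?_⟩
    rw [List.map_cons, List.prod_cons, hs x hx, List.map_cons, List.prod_cons, mul_smul_comm]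
  | swap a b l =>
    have hz : ∀ k : ZMod 2, k = 0 ∨ k = 1 := by decide
    by_cases h : π a = 0 ∨ π b = 0
    · refine ⟨1, fun x hx => ?_⟩
      have : x b * x a = x a * x b := by
        rcases h with h | h
        · exact (grassmann_comm (h ▸ hx a) (hx b)).symm
        · exact grassmann_comm (h ▸ hx b) (hx a)
      simp [← mul_assoc, this]
    · refine ⟨-1, fun x hx => ?_⟩
      rw [not_or] at h
      have : x b * x a = -(x a * x b) :=
        grassmann_anticomm ((hz _).resolve_left h.2 ▸ hx b) ((hz _).resolve_left h.1 ▸ hx a)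
      simp [← mul_assoc, this]
  | trans _ _ ih₁ ih₂ =>
    obtain ⟨s, hs⟩ := ih₁
    obtain ⟨t, ht⟩ := ih₂
    refine ⟨s * t, fun x hx => ?_⟩
    rw [hs x hx, ht x hx, smul_smul]
    push_cast
    rfl

theorem prod_ofFn_comp_perm_of_even {n : ℕ} (x : Fin n → Grassmann K)
    (hx : ∀ i, x i ∈ grassmannPart K 0) (σ : Equiv.Perm (Fin n)) :
    (List.ofFn (x ∘ σ)).prod = (List.ofFn x).prod :=
  (Equiv.Perm.ofFn_comp_perm σ x).prod_eq' <| List.pairwise_ofFn.2 fun _ _ _ =>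
    grassmann_comm (hx _) (hx _)

theorem prod_ofFn_comp_perm_of_odd {n : ℕ} (x : Fin n → Grassmann K)
    (hx : ∀ i, x i ∈ grassmannPart K 1) (σ : Equiv.Perm (Fin n)) :
    (List.ofFn (x ∘ σ)).prod = ((Equiv.Perm.sign σ : ℤ) : K) • (List.ofFn x).prod := by
  induction σ using Equiv.Perm.swap_induction_on generalizing x with
  | one => simp
  | swap_mul σ i j hij ih =>
    -- A transposition `(i j)` is treated by moving the factors `i` and `j` to the front.
    have hnd : (List.finRange n).Nodup := List.nodup_finRange n
    have hi : i ∈ List.finRange n := List.mem_finRange i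
    have hj : j ∈ (List.finRange n).erase i :=
      (List.mem_erase_of_ne hij.symm).2 (List.mem_finRange j)
    have hperm : (List.finRange n).Perm (i :: j :: ((List.finRange n).erase i).erase j) :=
      (List.perm_cons_erase hi).trans ((List.perm_cons_erase hj).cons i)
    have hfix : ∀ k ∈ ((List.finRange n).erase i).erase j, x (Equiv.swap i j k) = x k := by
      intro k hk
      rw [(hnd.erase i).mem_erase_iff, hnd.mem_erase_iff] at hk
      rw [Equiv.swap_apply_of_ne_of_ne hk.2.1 hk.1]
    obtain ⟨s, hs⟩ := exists_sign_of_perm (K := K) (fun _ : Fin n => (1 : ZMod 2)) hperm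
    have hswap : (List.ofFn (x ∘ Equiv.swap i j)).prod = -(List.ofFn x).prod := by
      rw [List.ofFn_eq_map, List.ofFn_eq_map, hs _ hx, hs (x ∘ Equiv.swap i j) (fun _ => hx _)]
      simp only [List.map_cons, List.prod_cons, Function.comp_apply, Equiv.swap_apply_left,
        Equiv.swap_apply_right]
      have hrest : (((List.finRange n).erase i).erase j).map (x ∘ Equiv.swap i j) =
          (((List.finRange n).erase i).erase j).map x := List.map_congr_left hfix
      rw [hrest, ← mul_assoc, grassmann_anticomm (hx j) (hx i), neg_mul, smul_neg, mul_assoc]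
    rw [Equiv.Perm.coe_mul, ← Function.comp_assoc, ih (x ∘ Equiv.swap i j) (fun _ => hx _), hswap,
      Equiv.Perm.sign_mul, Equiv.Perm.sign_swap hij]
    simp

theorem prod_ofFn_ι_single_ne_zero (n : ℕ) :
    (List.ofFn fun i : Fin n => ExteriorAlgebra.ι K (Finsupp.single (i : ℕ) (1 : K))).prod ≠ 0 := by
  have h := (exteriorPower.ιMulti_family_linearIndependent_ofBasis K n
    (Finsupp.basisSingleOne (R := K) (ι := ℕ))).ne_zero
      (Set.powersetCard.ofFinEmbEquiv (Fin.valOrderEmb n))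
  intro h0
  refine h (Subtype.ext ?_)
  rw [exteriorPower.ιMulti_family, Equiv.symm_apply_apply, exteriorPower.ιMulti_apply_coe,
    ExteriorAlgebra.ιMulti_apply]
  simpa [Function.comp_def] using h0

end Signs

/-! ### Evaluation of words -/

section Words

/-- The degree of a variable. -/
def Var.parity : Var → ZMod 2
  | .y0 _ => 0
  | .y1 _ => 1
  | .z0 _ => 0
  | .z1 _ => 1

/-- One of the scalar matrices `1`, `e₁₂`, `e₁₁ - e₂₂` and `e₂₁`, such that the values of the given
variable are its multiples by the elements of `E` whose degree is that of the variable. -/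
def Var.unit (K : Type*) [Field K] : Var → Matrix (Fin 2) (Fin 2) K
  | .y0 _ => 1
  | .y1 _ => !![0, 1; 0, 0]
  | .z0 _ => !![1, 0; 0, -1]
  | .z1 _ => !![0, 0; 1, 0]

variable {K : Type*} [Field K]

/-- The matrix `x A` over the Grassmann algebra, for `x` in the Grassmann algebra and a scalar
matrix `A`, as a linear function of `A`. -/
def scaled (x : Grassmann K) :
    Matrix (Fin 2) (Fin 2) K →ₗ[K] Matrix (Fin 2) (Fin 2) (Grassmann K) where
  toFun A := Matrix.of fun i j => A i j • x
  map_add' A B := by ext i j; simp [add_smul]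
  map_smul' c A := by ext i j; exact mul_smul c (A i j) x

theorem scaled_apply (x : Grassmann K) (A : Matrix (Fin 2) (Fin 2) K) (i j : Fin 2) :
    scaled x A i j = A i j • x := rfl

theorem scaled_smul (c : K) (x : Grassmann K) (A : Matrix (Fin 2) (Fin 2) K) :
    scaled (c • x) A = c • scaled x A := by
  ext i j
  exact smul_comm (A i j) c x

theorem scaled_mul_scaled (x y : Grassmann K) (A B : Matrix (Fin 2) (Fin 2) K) :
    scaled x A * scaled y B = scaled (x * y) (A * B) := by
  ext i j
  simp only [scaled_apply, Matrix.mul_apply, smul_mul_smul_comm, Finset.sum_smul]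

theorem scaled_injective {x : Grassmann K} (hx : x ≠ 0) : Function.Injective (scaled x) := by
  intro A B h
  ext i j
  exact smul_left_injective K hx (congrFun (congrFun h i) j)

/-- `x` gives the Grassmann coefficients of the substitution `φ` of elements of `M_{1,1}(E)`:
the value of each variable `v` is `x v` times the scalar matrix of `v`. -/
structure IsCoefficients (φ : Var → M11 K) (x : Var → Grassmann K) : Prop where
  mem : ∀ v, x v ∈ grassmannPart K v.parity
  eq : ∀ v, (φ v : Matrix (Fin 2) (Fin 2) (Grassmann K)) = scaled (x v) (v.unit K)

theorem IsCoefficients.comp_renameVar {φ : Var → M11 K} {x : Var → Grassmann K}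
    (h : IsCoefficients φ x) {n₁ n₂ n₃ n₄ : ℕ} (g : SymProd n₁ n₂ n₃ n₄) :
    IsCoefficients (φ ∘ renameVar g) (x ∘ renameVar g) where
  mem
    | .y0 i => h.mem (renameVar g (.y0 i))
    | .y1 i => h.mem (renameVar g (.y1 i))
    | .z0 i => h.mem (renameVar g (.z0 i))
    | .z1 i => h.mem (renameVar g (.z1 i))
  eq
    | .y0 i => h.eq (renameVar g (.y0 i))
    | .y1 i => h.eq (renameVar g (.y1 i))
    | .z0 i => h.eq (renameVar g (.z0 i))
    | .z1 i => h.eq (renameVar g (.z1 i))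

theorem Admissible.exists_coefficients [CharZero K] {φ : Var → M11 K}
    (h : Admissible (M11.involution K) φ) : ∃ x, IsCoefficients φ x := by
  -- As `2 ≠ 0`, one off-diagonal entry of a symmetric or skew-symmetric element of degree `1` is `0`.
  have key : ∀ a : Grassmann K, a = -a → a = 0 := fun a ha => by
    have h2 : (2 : K) • a = 0 := by rw [two_smul, ← eq_neg_iff_add_eq_zero, ← ha]
    exact (smul_eq_zero.1 h2).resolve_left two_ne_zero
  have hstar : ∀ M : M11 K, (((M11.involution K).star M : M11 K) :
      Matrix (Fin 2) (Fin 2) (Grassmann K)) = !![M.1 1 1, M.1 0 1; -M.1 1 0, M.1 0 0] :=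
    fun _ => rfl
  refine ⟨fun v => match v with
    | .y0 i => (φ (.y0 i)).1 0 0
    | .y1 i => (φ (.y1 i)).1 0 1
    | .z0 i => (φ (.z0 i)).1 0 0
    | .z1 i => (φ (.z1 i)).1 1 0, ?_, ?_⟩
  · rintro (i | i | i | i)
    · exact (φ _).2.1
    · exact (φ _).2.2.2.1
    · exact (φ _).2.1
    · exact (φ _).2.2.2.2
  · rintro (i | i | i | i)
    · obtain ⟨⟨h₀, -⟩, h₁⟩ := h.y0 i
      have e := congrFun (congrFun (congrArg Subtype.val h₁) 0) 0
      rw [hstar] at e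
      ext k l
      fin_cases k <;> fin_cases l
      exacts [(one_smul K _).symm, (h₀ rfl).1.trans (zero_smul K _).symm,
        (h₀ rfl).2.trans (zero_smul K _).symm, e.trans (one_smul K _).symm]
    · obtain ⟨⟨-, h₀⟩, h₁⟩ := h.y1 i
      have e := key _ (congrFun (congrFun (congrArg Subtype.val h₁) 1) 0).symm
      ext k l
      fin_cases k <;> fin_cases l
      exacts [(h₀ rfl).1.trans (zero_smul K _).symm, (one_smul K _).symm,
        e.trans (zero_smul K _).symm, (h₀ rfl).2.trans (zero_smul K _).symm]
    · obtain ⟨⟨h₀, -⟩, h₁⟩ := h.z0 i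
      have e := congrFun (congrFun (congrArg Subtype.val h₁) 0) 0
      rw [hstar] at e
      ext k l
      fin_cases k <;> fin_cases l
      exacts [(one_smul K _).symm, (h₀ rfl).1.trans (zero_smul K _).symm,
        (h₀ rfl).2.trans (zero_smul K _).symm, e.trans (neg_one_smul K _).symm]
    · obtain ⟨⟨-, h₀⟩, h₁⟩ := h.z1 i
      have e := key _ (congrFun (congrFun (congrArg Subtype.val h₁) 0) 1)
      ext k l
      fin_cases k <;> fin_cases l
      exacts [(h₀ rfl).1.trans (zero_smul K _).symm, e.trans (zero_smul K _).symm,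
        (one_smul K _).symm, (h₀ rfl).2.trans (zero_smul K _).symm]

theorem exists_admissible_of_mem {x : Var → Grassmann K}
    (hx : ∀ v, x v ∈ grassmannPart K v.parity) :
    ∃ φ : Var → M11 K, Admissible (M11.involution K) φ ∧ IsCoefficients φ x := by
  refine ⟨fun v => ⟨scaled (x v) (v.unit K), ?_⟩, ⟨?_, ?_, ?_, ?_⟩, hx, fun v => rfl⟩
  · have := hx v
    rcases v with i | i | i | i <;> simpa [M11, scaled_apply, Var.unit, Var.parity] using this
  all_goals
    refine fun i => ⟨by simp [M11.grading, scaled_apply, Var.unit], Subtype.ext ?_⟩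
    refine (M11.coe_star K _).trans ?_
    ext k l
    fin_cases k <;> fin_cases l <;> simp [scaled_apply, Var.unit]

/-- The words which form the usual basis of `P_{n₁,n₂,n₃,n₄}`. -/
structure IsMultilinearWord (n₁ n₂ n₃ n₄ : ℕ) (l : List Var) : Prop where
  nodup : l.Nodup
  mem_iff : ∀ v, v ∈ l ↔ v.InRange n₁ n₂ n₃ n₄

theorem IsMultilinearWord.perm {n₁ n₂ n₃ n₄ : ℕ} {l l' : List Var}
    (h : IsMultilinearWord n₁ n₂ n₃ n₄ l) (h' : IsMultilinearWord n₁ n₂ n₃ n₄ l') : l.Perm l' :=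
  (List.perm_ext_iff_of_nodup h.nodup h'.nodup).2 fun v => by rw [h.mem_iff, h'.mem_iff]

/-- The word in which the variables of each kind come in their natural order, and the kinds in the
order `y0`, `z0`, `y1`, `z1`. -/
def standardWord (n₁ n₂ n₃ n₄ : ℕ) : List Var :=
  (List.ofFn fun i : Fin n₁ => Var.y0 i) ++ (List.ofFn fun i : Fin n₃ => Var.z0 i) ++
    (List.ofFn fun i : Fin n₂ => Var.y1 i) ++ List.ofFn fun i : Fin n₄ => Var.z1 i

theorem isMultilinearWord_standardWord (n₁ n₂ n₃ n₄ : ℕ) :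
    IsMultilinearWord n₁ n₂ n₃ n₄ (standardWord n₁ n₂ n₃ n₄) where
  nodup := by
    simp only [standardWord, List.nodup_append', List.nodup_ofFn, List.disjoint_append_left]
    simp [Function.Injective, Fin.ext_iff, List.Disjoint, List.mem_ofFn]
  mem_iff v := by
    cases v <;> simp [standardWord, List.mem_ofFn, Var.InRange, Fin.exists_iff]

theorem prod_standardWord (n₁ n₂ n₃ n₄ : ℕ) (x : Var → Grassmann K) :
    ((standardWord n₁ n₂ n₃ n₄).map x).prod =
      (List.ofFn fun i : Fin n₁ => x (.y0 i)).prod * (List.ofFn fun i : Fin n₃ => x (.z0 i)).prod *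
        (List.ofFn fun i : Fin n₂ => x (.y1 i)).prod *
          (List.ofFn fun i : Fin n₄ => x (.z1 i)).prod := by
  simp only [standardWord, List.map_append, List.prod_append, List.map_ofFn]
  rfl

theorem extendPerm_val {n : ℕ} (σ : Equiv.Perm (Fin n)) (i : Fin n) :
    extendPerm n σ i = σ i := by
  have := Equiv.Perm.extendDomain_apply_image σ (Fin.equivSubtype (n := n)) i
  simp only [Fin.equivSubtype_apply] at this
  exact this

theorem prod_standardWord_renameVar {n₁ n₂ n₃ n₄ : ℕ} (g : SymProd n₁ n₂ n₃ n₄)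
    {x : Var → Grassmann K} (hx : ∀ v, x v ∈ grassmannPart K v.parity) :
    ((standardWord n₁ n₂ n₃ n₄).map (x ∘ renameVar g)).prod =
      (((Equiv.Perm.sign g.2.1 : ℤ) : K) * ((Equiv.Perm.sign g.2.2.2 : ℤ) : K)) •
        ((standardWord n₁ n₂ n₃ n₄).map x).prod := by
  have h₁ := prod_ofFn_comp_perm_of_even (fun i : Fin n₁ => x (.y0 i)) (fun i => hx (.y0 i)) g.1
  have h₂ := prod_ofFn_comp_perm_of_odd (fun i : Fin n₂ => x (.y1 i)) (fun i => hx (.y1 i)) g.2.1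
  have h₃ := prod_ofFn_comp_perm_of_even (fun i : Fin n₃ => x (.z0 i)) (fun i => hx (.z0 i)) g.2.2.1
  have h₄ := prod_ofFn_comp_perm_of_odd (fun i : Fin n₄ => x (.z1 i)) (fun i => hx (.z1 i)) g.2.2.2
  simp only [Function.comp_def] at h₁ h₂ h₃ h₄
  simp only [prod_standardWord, Function.comp_apply, renameVar, extendPerm_val, h₁, h₂, h₃, h₄,
    smul_mul_assoc, mul_smul_comm, smul_smul]
  rw [mul_comm]

theorem exists_prod_standardWord_ne_zero (n₁ n₂ n₃ n₄ : ℕ) :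
    ∃ x : Var → Grassmann K, (∀ v, x v ∈ grassmannPart K v.parity) ∧
      ((standardWord n₁ n₂ n₃ n₄).map x).prod ≠ 0 := by
  -- The variables of degree `1` receive distinct generators, numbered consecutively in the order in
  -- which they occur in the standard word.
  have h1 : (1 : Grassmann K) ∈ grassmannPart K 0 :=
    CliffordAlgebra.one_le_evenOdd_zero _ (Submodule.one_le.1 le_rfl)
  have hι : ∀ i : ℕ, ExteriorAlgebra.ι K (Finsupp.single i (1 : K)) ∈ grassmannPart K 1 :=
    fun i => CliffordAlgebra.ι_mem_evenOdd_one _ _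
  refine ⟨fun v => match v with
    | .y0 _ => 1
    | .y1 i => ExteriorAlgebra.ι K (Finsupp.single i 1)
    | .z0 _ => 1
    | .z1 i => ExteriorAlgebra.ι K (Finsupp.single (n₂ + i) 1), ?_, ?_⟩
  · rintro (i | i | i | i)
    exacts [h1, hι _, h1, hι _]
  · have h := prod_ofFn_ι_single_ne_zero (K := K) (n₂ + n₄)
    rw [List.ofFn_add, List.prod_append] at h
    simpa [prod_standardWord] using h

theorem lift_word {φ : Var → M11 K} {x : Var → Grassmann K} (h : IsCoefficients φ x)
    (l : List Var) :
    ((FreeAlgebra.lift K φ (l.map (FreeAlgebra.ι K)).prod : M11 K) :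
      Matrix (Fin 2) (Fin 2) (Grassmann K)) =
        scaled (l.map x).prod (l.map (Var.unit K)).prod := by
  induction l with
  | nil =>
    ext i j
    fin_cases i <;> fin_cases j <;> simp [scaled_apply]
  | cons v l ih =>
    simp only [List.map_cons, List.prod_cons, map_mul, FreeAlgebra.lift_ι_apply]
    rw [← scaled_mul_scaled, ← ih, ← h.eq]
    rfl

/-- The span of the products of the scalar matrices `Var.unit K v` along the multilinear words. -/
def unitSpan (K : Type*) [Field K] (n₁ n₂ n₃ n₄ : ℕ) :
    Submodule K (Matrix (Fin 2) (Fin 2) K) :=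
  Submodule.span K ((fun l => (l.map (Var.unit K)).prod) '' {l | IsMultilinearWord n₁ n₂ n₃ n₄ l})

/-- All values of a multilinear polynomial are multiples of one scalar matrix; the factor is
the product of the Grassmann coefficients in the standard order. -/
theorem exists_lift_eq_scaled {n₁ n₂ n₃ n₄ : ℕ} {f : FreeAlgebra K Var}
    (hf : f ∈ multilinear K n₁ n₂ n₃ n₄) :
    ∃ A ∈ unitSpan K n₁ n₂ n₃ n₄, ∀ φ x, IsCoefficients φ x →
      ((FreeAlgebra.lift K φ f : M11 K) : Matrix (Fin 2) (Fin 2) (Grassmann K)) =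
        scaled ((standardWord n₁ n₂ n₃ n₄).map x).prod A := by
  induction hf using Submodule.span_induction with
  | mem f hf =>
    obtain ⟨l, hl, hmem, rfl⟩ := hf
    have hw : IsMultilinearWord n₁ n₂ n₃ n₄ l := ⟨hl, hmem⟩
    obtain ⟨s, hs⟩ := exists_sign_of_perm (K := K) Var.parity
      (hw.perm (isMultilinearWord_standardWord n₁ n₂ n₃ n₄))
    refine ⟨((s : ℤ) : K) • (l.map (Var.unit K)).prod,
      Submodule.smul_mem _ _ (Submodule.subset_span ⟨l, hw, rfl⟩), fun φ x h => ?_⟩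
    rw [lift_word h, hs x h.mem, scaled_smul, map_smul]
  | zero => exact ⟨0, zero_mem _, fun φ x _ => by simp⟩
  | add f g _ _ hf hg =>
    obtain ⟨A, hA, hA'⟩ := hf
    obtain ⟨B, hB, hB'⟩ := hg
    exact ⟨A + B, add_mem hA hB, fun φ x h => by
      rw [map_add, Subalgebra.coe_add, hA' φ x h, hB' φ x h, map_add]⟩
  | smul c f _ hf =>
    obtain ⟨A, hA, hA'⟩ := hf
    exact ⟨c • A, Submodule.smul_mem _ _ hA, fun φ x h => by
      rw [map_smul, Subalgebra.coe_smul, hA' φ x h, map_smul]⟩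

variable [CharZero K]

theorem quotientAction_eq {n₁ n₂ n₃ n₄ : ℕ} (g : SymProd n₁ n₂ n₃ n₄) :
    quotientAction (M11.involution K) n₁ n₂ n₃ n₄ g =
      (((Equiv.Perm.sign g.2.1 : ℤ) : K) * ((Equiv.Perm.sign g.2.2.2 : ℤ) : K)) •
        LinearMap.id := by
  refine LinearMap.ext fun v => ?_
  obtain ⟨f, rfl⟩ := Submodule.Quotient.mk_surjective _ v
  refine (Submodule.Quotient.eq _).2 ?_
  intro φ hφ
  obtain ⟨x, hx⟩ := hφ.exists_coefficients
  obtain ⟨A, -, hA⟩ := exists_lift_eq_scaled f.2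
  have e : FreeAlgebra.lift K (φ ∘ renameVar g) =
      (FreeAlgebra.lift K φ).comp (FreeAlgebra.lift K (FreeAlgebra.ι K ∘ renameVar g)) := by
    ext v; simp
  have h₁ := hA _ _ (hx.comp_renameVar g)
  rw [e, prod_standardWord_renameVar g hx.mem, scaled_smul, ← hA _ _ hx] at h₁
  have h₂ := sub_eq_zero.2 (Subtype.ext h₁ : _ = (((Equiv.Perm.sign g.2.1 : ℤ) : K) *
    ((Equiv.Perm.sign g.2.2.2 : ℤ) : K)) • FreeAlgebra.lift K φ f)
  rw [← map_smul, AlgHom.comp_apply, ← map_sub] at h₂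
  exact h₂

/-- A substitution whose coefficients have a nonzero product detects all multilinear identities, so
`P / (P ∩ Id)` is isomorphic to the space of values of this substitution. -/
theorem nonempty_quotient_equiv (n₁ n₂ n₃ n₄ : ℕ) :
    Nonempty ((multilinear K n₁ n₂ n₃ n₄ ⧸
      multilinearIdentities (M11.involution K) n₁ n₂ n₃ n₄) ≃ₗ[K] unitSpan K n₁ n₂ n₃ n₄) := by
  obtain ⟨x, hx, hx0⟩ := exists_prod_standardWord_ne_zero (K := K) n₁ n₂ n₃ n₄
  obtain ⟨φ, hφ, hφx⟩ := exists_admissible_of_mem hx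
  let L : multilinear K n₁ n₂ n₃ n₄ →ₗ[K] Matrix (Fin 2) (Fin 2) (Grassmann K) :=
    (M11 K).val.toLinearMap ∘ₗ (FreeAlgebra.lift K φ).toLinearMap ∘ₗ Submodule.subtype _
  have hL : ∀ f, L f = ((FreeAlgebra.lift K φ (f : FreeAlgebra K Var) : M11 K) :
      Matrix (Fin 2) (Fin 2) (Grassmann K)) := fun _ => rfl
  have hker : multilinearIdentities (M11.involution K) n₁ n₂ n₃ n₄ = LinearMap.ker L := by
    ext f
    rw [LinearMap.mem_ker, hL]
    constructor
    · intro hf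
      exact congrArg Subtype.val (hf φ hφ)
    · intro hf ψ hψ
      obtain ⟨y, hy⟩ := hψ.exists_coefficients
      obtain ⟨A, -, hA⟩ := exists_lift_eq_scaled f.2
      have hA0 : A = 0 := by
        refine scaled_injective hx0 ?_
        rw [← hA φ x hφx, hf, map_zero]
      refine Subtype.ext ?_
      exact (hA ψ y hy).trans (by rw [hA0, map_zero]; rfl)
  have hrange : LinearMap.range L =
      (unitSpan K n₁ n₂ n₃ n₄).map (scaled ((standardWord n₁ n₂ n₃ n₄).map x).prod) := by
    refine le_antisymm ?_ ?_
    · rintro _ ⟨f, rfl⟩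
      obtain ⟨A, hA, hA'⟩ := exists_lift_eq_scaled f.2
      exact ⟨A, hA, (hA' φ x hφx).symm⟩
    · rw [unitSpan, Submodule.map_span_le]
      rintro _ ⟨l, hl, rfl⟩
      obtain ⟨s, hs⟩ := exists_sign_of_perm (K := K) Var.parity
        ((isMultilinearWord_standardWord n₁ n₂ n₃ n₄).perm hl)
      refine ⟨((s : ℤ) : K) • ⟨(l.map (FreeAlgebra.ι K)).prod,
        Submodule.subset_span ⟨l, hl.nodup, hl.mem_iff, rfl⟩⟩, ?_⟩
      rw [map_smul, hL, lift_word hφx, hs x hx, scaled_smul]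
  exact ⟨Submodule.quotEquivOfEq _ _ hker ≪≫ₗ L.quotKerEquivRange ≪≫ₗ
    LinearEquiv.ofEq _ _ hrange ≪≫ₗ
      (Submodule.equivMapOfInjective _ (scaled_injective hx0) _).symm⟩

theorem cocharacter_eq {n₁ n₂ n₃ n₄ : ℕ} (g : SymProd n₁ n₂ n₃ n₄) :
    cocharacter (M11.involution K) n₁ n₂ n₃ n₄ g =
      (Module.finrank K (unitSpan K n₁ n₂ n₃ n₄) : K) *
        (((Equiv.Perm.sign g.2.1 : ℤ) : K) * ((Equiv.Perm.sign g.2.2.2 : ℤ) : K)) := by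
  obtain ⟨e⟩ := nonempty_quotient_equiv (K := K) n₁ n₂ n₃ n₄
  have := Module.Finite.equiv e.symm
  rw [cocharacter, Representation.character, quotientAction_eq, map_smul, LinearMap.trace_id,
    e.finrank_eq, smul_eq_mul, mul_comm]

end Words

/-! ### The dimension of the multilinear components -/

section Dimension

variable {K : Type*} [Field K]

/-- The degree of a variable for the `ℤ`-grading in which `e₁₂` has degree `1` and `e₂₁` has
degree `-1`. -/
def Var.weight : Var → ℤ
  | .y0 _ => 0
  | .y1 _ => 1
  | .z0 _ => 0
  | .z1 _ => -1

theorem weight_eq_of_unit_ne_zero (v : Var) (i j : Fin 2) (h : v.unit K i j ≠ 0) :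
    v.weight = (j : ℤ) - i := by
  cases v <;> fin_cases i <;> fin_cases j <;> simp_all [Var.unit, Var.weight]

/-- The matrix product respects the `ℤ`-grading by diagonals: a product of letters can only have
a nonzero entry at `(i, j)` if its total weight is `j - i`. In particular at most the weights `-1`,
`0` and `1` give anything nonzero. -/
theorem weight_eq_of_prod_unit_ne_zero (l : List Var) (i j : Fin 2)
    (h : (l.map (Var.unit K)).prod i j ≠ 0) : (l.map Var.weight).sum = (j : ℤ) - i := by
  induction l generalizing i with
  | nil =>
    obtain rfl : i = j := by
      by_contra hij
      simp [Matrix.one_apply_ne hij] at h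
    simp
  | cons v l ih =>
    rw [List.map_cons, List.prod_cons, Matrix.mul_apply] at h
    obtain ⟨k, -, hk⟩ := Finset.exists_ne_zero_of_sum_ne_zero h
    rw [List.map_cons, List.sum_cons, ih k (right_ne_zero_of_mul hk),
      weight_eq_of_unit_ne_zero v i k (left_ne_zero_of_mul hk)]
    ring

theorem IsMultilinearWord.sum_weight {n₁ n₂ n₃ n₄ : ℕ} {l : List Var}
    (h : IsMultilinearWord n₁ n₂ n₃ n₄ l) : (l.map Var.weight).sum = (n₂ : ℤ) - n₄ := by
  rw [((h.perm (isMultilinearWord_standardWord n₁ n₂ n₃ n₄)).map _).sum_eq]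
  simp [standardWord, Function.comp_def, Var.weight, sub_eq_add_neg]

theorem apply_eq_zero_of_mem_unitSpan {n₁ n₂ n₃ n₄ : ℕ} {A : Matrix (Fin 2) (Fin 2) K}
    (hA : A ∈ unitSpan K n₁ n₂ n₃ n₄) (i j : Fin 2) (h : (n₂ : ℤ) - n₄ ≠ (j : ℤ) - i) :
    A i j = 0 := by
  induction hA using Submodule.span_induction with
  | mem A hA =>
    obtain ⟨l, hl, rfl⟩ := hA
    by_contra h0
    exact h (by rw [← weight_eq_of_prod_unit_ne_zero l i j h0, IsMultilinearWord.sum_weight hl])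
  | zero => rfl
  | add A B _ _ hA hB => rw [Matrix.add_apply, hA, hB, add_zero]
  | smul c A _ hA => rw [Matrix.smul_apply, hA, smul_zero]

theorem IsMultilinearWord.cons {n₁ n₂ n₃ n₄ m₁ m₂ m₃ m₄ : ℕ} {l : List Var}
    (h : IsMultilinearWord n₁ n₂ n₃ n₄ l) {v : Var} (hv : ¬ v.InRange n₁ n₂ n₃ n₄)
    (hm : ∀ w : Var, w.InRange m₁ m₂ m₃ m₄ ↔ w = v ∨ w.InRange n₁ n₂ n₃ n₄) :
    IsMultilinearWord m₁ m₂ m₃ m₄ (v :: l) where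
  nodup := List.nodup_cons.2 ⟨fun hl => hv ((h.mem_iff v).1 hl), h.nodup⟩
  mem_iff w := by rw [List.mem_cons, h.mem_iff, hm]

/-- Prepending a new letter to the words. -/
theorem unit_mul_mem_unitSpan {n₁ n₂ n₃ n₄ m₁ m₂ m₃ m₄ : ℕ} {A : Matrix (Fin 2) (Fin 2) K}
    (hA : A ∈ unitSpan K n₁ n₂ n₃ n₄) {v : Var} (hv : ¬ v.InRange n₁ n₂ n₃ n₄)
    (hm : ∀ w : Var, w.InRange m₁ m₂ m₃ m₄ ↔ w = v ∨ w.InRange n₁ n₂ n₃ n₄) :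
    v.unit K * A ∈ unitSpan K m₁ m₂ m₃ m₄ := by
  have : unitSpan K n₁ n₂ n₃ n₄ ≤
      (unitSpan K m₁ m₂ m₃ m₄).comap (LinearMap.mulLeft K (v.unit K)) := by
    refine Submodule.span_le.2 ?_
    rintro _ ⟨l, hl, rfl⟩
    exact Submodule.subset_span ⟨v :: l, IsMultilinearWord.cons hl hv hm, by simp⟩
  exact this hA

theorem mem_unitSpan_succ {n₁ n₂ n₃ n₄ : ℕ} {A : Matrix (Fin 2) (Fin 2) K}
    (hA : A ∈ unitSpan K n₁ n₂ n₃ n₄) : A ∈ unitSpan K (n₁ + 1) n₂ n₃ n₄ := by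
  simpa [Var.unit] using unit_mul_mem_unitSpan hA (v := .y0 n₁) (lt_irrefl n₁)
    (by rintro (i | i | i | i) <;> simp [Var.InRange]; omega)

theorem y1_mul_mem_unitSpan {n₁ n₂ n₃ n₄ : ℕ} {A : Matrix (Fin 2) (Fin 2) K}
    (hA : A ∈ unitSpan K n₁ n₂ n₃ n₄) : !![0, 1; 0, 0] * A ∈ unitSpan K n₁ (n₂ + 1) n₃ n₄ :=
  unit_mul_mem_unitSpan hA (v := .y1 n₂) (lt_irrefl n₂)
    (by rintro (i | i | i | i) <;> simp [Var.InRange]; omega)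

theorem z0_mul_mem_unitSpan {n₁ n₂ n₃ n₄ : ℕ} {A : Matrix (Fin 2) (Fin 2) K}
    (hA : A ∈ unitSpan K n₁ n₂ n₃ n₄) : !![1, 0; 0, -1] * A ∈ unitSpan K n₁ n₂ (n₃ + 1) n₄ :=
  unit_mul_mem_unitSpan hA (v := .z0 n₃) (lt_irrefl n₃)
    (by rintro (i | i | i | i) <;> simp [Var.InRange]; omega)

theorem z1_mul_mem_unitSpan {n₁ n₂ n₃ n₄ : ℕ} {A : Matrix (Fin 2) (Fin 2) K}
    (hA : A ∈ unitSpan K n₁ n₂ n₃ n₄) : !![0, 0; 1, 0] * A ∈ unitSpan K n₁ n₂ n₃ (n₄ + 1) :=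
  unit_mul_mem_unitSpan hA (v := .z1 n₄) (lt_irrefl n₄)
    (by rintro (i | i | i | i) <;> simp [Var.InRange]; omega)

/-- If `e₁₁ - e₂₂` fixes `A` up to sign, then letters of degree `0` can be put in front of the words
producing `A`. -/
theorem mem_unitSpan_of_mem {n₂ n₄ : ℕ} {A : Matrix (Fin 2) (Fin 2) K}
    (hA : A ∈ unitSpan K 0 n₂ 0 n₄)
    (h : !![1, 0; 0, -1] * A = A ∨ !![1, 0; 0, -1] * A = -A) (n₁ n₃ : ℕ) :
    A ∈ unitSpan K n₁ n₂ n₃ n₄ := by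
  have h₁ : A ∈ unitSpan K n₁ n₂ 0 n₄ := by
    induction n₁ with
    | zero => exact hA
    | succ n ih => exact mem_unitSpan_succ ih
  induction n₃ with
  | zero => exact h₁
  | succ n ih =>
    have := z0_mul_mem_unitSpan ih
    rcases h with h | h
    · rwa [h] at this
    · rwa [h, neg_mem_iff] at this

theorem one_mem_unitSpan : 1 ∈ unitSpan K 0 0 0 0 :=
  Submodule.subset_span
    ⟨[], ⟨List.nodup_nil, by rintro (i | i | i | i) <;> simp [Var.InRange]⟩, rfl⟩

theorem e₁₁_mem_unitSpan (n : ℕ) : !![1, 0; 0, 0] ∈ unitSpan K 0 (n + 1) 0 (n + 1) := by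
  induction n with
  | zero => simpa only [Matrix.mul_fin_two, mul_one, mul_zero, zero_mul, add_zero, zero_add]
      using y1_mul_mem_unitSpan (z1_mul_mem_unitSpan (one_mem_unitSpan (K := K)))
  | succ n ih => simpa only [Matrix.mul_fin_two, mul_one, mul_zero, zero_mul, add_zero, zero_add]
      using y1_mul_mem_unitSpan (z1_mul_mem_unitSpan ih)

theorem e₂₂_mem_unitSpan (n : ℕ) : !![0, 0; 0, 1] ∈ unitSpan K 0 (n + 1) 0 (n + 1) := by
  induction n with
  | zero => simpa only [Matrix.mul_fin_two, mul_one, mul_zero, zero_mul, add_zero, zero_add]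
      using z1_mul_mem_unitSpan (y1_mul_mem_unitSpan (one_mem_unitSpan (K := K)))
  | succ n ih => simpa only [Matrix.mul_fin_two, mul_one, mul_zero, zero_mul, add_zero, zero_add]
      using z1_mul_mem_unitSpan (y1_mul_mem_unitSpan ih)

theorem e₁₂_mem_unitSpan (n : ℕ) : !![0, 1; 0, 0] ∈ unitSpan K 0 (n + 1) 0 n := by
  cases n with
  | zero => simpa only [Matrix.mul_fin_two, mul_one, mul_zero, zero_mul, add_zero, zero_add]
      using y1_mul_mem_unitSpan (one_mem_unitSpan (K := K))
  | succ n => simpa only [Matrix.mul_fin_two, mul_one, mul_zero, zero_mul, add_zero, zero_add]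
      using y1_mul_mem_unitSpan (e₂₂_mem_unitSpan (K := K) n)

theorem e₂₁_mem_unitSpan (n : ℕ) : !![0, 0; 1, 0] ∈ unitSpan K 0 n 0 (n + 1) := by
  cases n with
  | zero => simpa only [Matrix.mul_fin_two, mul_one, mul_zero, zero_mul, add_zero, zero_add]
      using z1_mul_mem_unitSpan (one_mem_unitSpan (K := K))
  | succ n => simpa only [Matrix.mul_fin_two, mul_one, mul_zero, zero_mul, add_zero, zero_add]
      using z1_mul_mem_unitSpan (e₁₁_mem_unitSpan (K := K) n)

/-- Without letters of degree `1` all letters commute, so all words have the same product, a power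
of `e₁₁ - e₂₂`. -/
theorem finrank_unitSpan_zero (n₁ n₃ : ℕ) : Module.finrank K (unitSpan K n₁ 0 n₃ 0) = 1 := by
  have hunit : IsUnit (!![1, 0; 0, -1] : Matrix (Fin 2) (Fin 2) K) := by
    refine IsUnit.of_mul_eq_one !![1, 0; 0, -1] ?_
    simp [Matrix.one_fin_two]
  have hst : ((standardWord n₁ 0 n₃ 0).map (Var.unit K)).prod = !![1, 0; 0, -1] ^ n₃ := by
    simp [standardWord, List.map_ofFn, Function.comp_def, Var.unit, List.ofFn_const]
  have hspan : unitSpan K n₁ 0 n₃ 0 =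
      Submodule.span K {(!![1, 0; 0, -1] : Matrix (Fin 2) (Fin 2) K) ^ n₃} := by
    rw [unitSpan]
    congr 1
    refine Set.eq_singleton_iff_unique_mem.2
      ⟨⟨_, isMultilinearWord_standardWord n₁ 0 n₃ 0, hst⟩, ?_⟩
    rintro _ ⟨l, hl, rfl⟩
    rw [← hst]
    refine (((IsMultilinearWord.perm hl
      (isMultilinearWord_standardWord n₁ 0 n₃ 0)).map _).prod_eq' ?_)
    refine List.pairwise_map.2 (List.pairwise_of_forall_mem_list fun v hv w hw => ?_)
    rw [IsMultilinearWord.mem_iff hl] at hv hw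
    cases v <;> cases w <;> simp_all [Var.InRange, Var.unit]
  rw [hspan, finrank_span_singleton (hunit.pow n₃).ne_zero]

/-- The words `(y z)⋯(y z)` and `(z y)⋯(z y)` in the letters of degree `1` have products `e₁₁` and
`e₂₂`, which span the diagonal matrices. -/
theorem finrank_unitSpan_diag (n₁ n n₃ : ℕ) :
    Module.finrank K (unitSpan K n₁ (n + 1) n₃ (n + 1)) = 2 := by
  have h₁ := mem_unitSpan_of_mem (e₁₁_mem_unitSpan (K := K) n) (by simp) n₁ n₃
  have h₂ := mem_unitSpan_of_mem (e₂₂_mem_unitSpan (K := K) n) (by simp) n₁ n₃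
  have hspan : unitSpan K n₁ (n + 1) n₃ (n + 1) =
      Submodule.span K (Set.range ![!![1, 0; 0, 0], !![0, 0; 0, 1]]) := by
    refine le_antisymm (fun A hA => ?_) (Submodule.span_le.2 ?_)
    · have h01 := apply_eq_zero_of_mem_unitSpan hA 0 1 (by simp)
      have h10 := apply_eq_zero_of_mem_unitSpan hA 1 0 (by simp)
      have : A = A 0 0 • !![1, 0; 0, 0] + A 1 1 • !![0, 0; 0, 1] := by
        ext i j
        fin_cases i <;> fin_cases j <;> simp [h01, h10]
      rw [this]
      exact add_mem (Submodule.smul_mem _ _ (Submodule.subset_span ⟨0, rfl⟩))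
        (Submodule.smul_mem _ _ (Submodule.subset_span ⟨1, rfl⟩))
    · rintro _ ⟨i, rfl⟩
      fin_cases i
      exacts [h₁, h₂]
  rw [hspan, finrank_span_eq_card, Fintype.card_fin]
  rw [LinearIndependent.pair_iff]
  intro s t hst
  exact ⟨by simpa using congrFun (congrFun hst 0) 0, by simpa using congrFun (congrFun hst 1) 1⟩

theorem finrank_unitSpan_succ_left (n₁ n n₃ : ℕ) :
    Module.finrank K (unitSpan K n₁ (n + 1) n₃ n) = 1 := by
  have h := mem_unitSpan_of_mem (e₁₂_mem_unitSpan (K := K) n) (by simp) n₁ n₃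
  have hspan : unitSpan K n₁ (n + 1) n₃ n = Submodule.span K {!![0, 1; 0, 0]} := by
    refine le_antisymm (fun A hA => Submodule.mem_span_singleton.2 ⟨A 0 1, ?_⟩) ?_
    · have h00 := apply_eq_zero_of_mem_unitSpan hA 0 0 (by simp)
      have h10 := apply_eq_zero_of_mem_unitSpan hA 1 0 (by simp)
      have h11 := apply_eq_zero_of_mem_unitSpan hA 1 1 (by simp)
      ext i j
      fin_cases i <;> fin_cases j <;> simp [h00, h10, h11]
    · rwa [Submodule.span_singleton_le_iff_mem]
  rw [hspan, finrank_span_singleton]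
  exact fun h0 => one_ne_zero (α := K) (congrFun (congrFun h0 0) 1)

theorem finrank_unitSpan_succ_right (n₁ n n₃ : ℕ) :
    Module.finrank K (unitSpan K n₁ n n₃ (n + 1)) = 1 := by
  have h := mem_unitSpan_of_mem (e₂₁_mem_unitSpan (K := K) n) (by simp) n₁ n₃
  have hspan : unitSpan K n₁ n n₃ (n + 1) = Submodule.span K {!![0, 0; 1, 0]} := by
    refine le_antisymm (fun A hA => Submodule.mem_span_singleton.2 ⟨A 1 0, ?_⟩) ?_
    · have h00 := apply_eq_zero_of_mem_unitSpan hA 0 0 (by simp)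
      have h01 := apply_eq_zero_of_mem_unitSpan hA 0 1 (by simp)
      have h11 := apply_eq_zero_of_mem_unitSpan hA 1 1 (by simp)
      ext i j
      fin_cases i <;> fin_cases j <;> simp [h00, h01, h11]
    · rwa [Submodule.span_singleton_le_iff_mem]
  rw [hspan, finrank_span_singleton]
  exact fun h0 => one_ne_zero (α := K) (congrFun (congrFun h0 1) 0)

theorem finrank_unitSpan_eq_zero (n₁ n₃ : ℕ) {n₂ n₄ : ℕ}
    (h : ¬ (n₂ = n₄ ∨ n₂ = n₄ + 1 ∨ n₄ = n₂ + 1)) :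
    Module.finrank K (unitSpan K n₁ n₂ n₃ n₄) = 0 := by
  have : unitSpan K n₁ n₂ n₃ n₄ = ⊥ := by
    refine (Submodule.eq_bot_iff _).2 fun A hA => ?_
    ext i j
    refine apply_eq_zero_of_mem_unitSpan hA i j ?_
    have := i.2
    have := j.2
    omega
  rw [this, finrank_bot]

end Dimension

end GradedStar

end

theorem mainTheorem2 (K : Type*) [Field K] [CharZero K] (m : GradedStar.MultiplicityFamily) :
    GradedStar.IsCocharacterMultiplicity (GradedStar.M11.involution K) m ↔
      (∀ n₁ n₃ : ℕ,
        m n₁ 0 n₃ 0 (GradedStar.oneRow n₁) (GradedStar.oneColumn 0)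
          (GradedStar.oneRow n₃) (GradedStar.oneColumn 0) = 1) ∧
      (∀ n₁ n₂ n₃ : ℕ, 1 ≤ n₂ →
        m n₁ n₂ n₃ n₂ (GradedStar.oneRow n₁) (GradedStar.oneColumn n₂)
          (GradedStar.oneRow n₃) (GradedStar.oneColumn n₂) = 2) ∧
      (∀ n₁ n₂ n₃ : ℕ,
        m n₁ (n₂ + 1) n₃ n₂ (GradedStar.oneRow n₁) (GradedStar.oneColumn (n₂ + 1))
          (GradedStar.oneRow n₃) (GradedStar.oneColumn n₂) = 1) ∧
      (∀ n₁ n₂ n₃ : ℕ,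
        m n₁ n₂ n₃ (n₂ + 1) (GradedStar.oneRow n₁) (GradedStar.oneColumn n₂)
          (GradedStar.oneRow n₃) (GradedStar.oneColumn (n₂ + 1)) = 1) ∧
      (∀ (n₁ n₂ n₃ n₄ : ℕ) (p₁ : n₁.Partition) (p₂ : n₂.Partition) (p₃ : n₃.Partition)
          (p₄ : n₄.Partition),
        ¬ (p₁ = GradedStar.oneRow n₁ ∧ p₂ = GradedStar.oneColumn n₂ ∧
            p₃ = GradedStar.oneRow n₃ ∧ p₄ = GradedStar.oneColumn n₄ ∧
            (n₂ = n₄ ∨ n₂ = n₄ + 1 ∨ n₄ = n₂ + 1)) →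
          m n₁ n₂ n₃ n₄ p₁ p₂ p₃ p₄ = 0) := by
  have key : GradedStar.IsCocharacterMultiplicity (GradedStar.M11.involution K) m ↔
      ∀ n₁ n₂ n₃ n₄ : ℕ,
        m n₁ n₂ n₃ n₄ (GradedStar.oneRow n₁) (GradedStar.oneColumn n₂) (GradedStar.oneRow n₃)
            (GradedStar.oneColumn n₄) =
          Module.finrank K (GradedStar.unitSpan K n₁ n₂ n₃ n₄) ∧
        ∀ p₁ p₂ p₃ p₄, ¬ (p₁ = GradedStar.oneRow n₁ ∧ p₂ = GradedStar.oneColumn n₂ ∧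
          p₃ = GradedStar.oneRow n₃ ∧ p₄ = GradedStar.oneColumn n₄) →
            m n₁ n₂ n₃ n₄ p₁ p₂ p₃ p₄ = 0 := by
    simp only [GradedStar.IsCocharacterMultiplicity, GradedStar.cocharacter_eq]
    exact forall_congr' fun n₁ => forall_congr' fun n₂ => forall_congr' fun n₃ =>
      forall_congr' fun n₄ => GradedStar.smul_sign_mul_sign_eq_sum_iff _ (m n₁ n₂ n₃ n₄)
  rw [key]
  constructor
  · intro h
    refine ⟨fun n₁ n₃ => ?_, fun n₁ n₂ n₃ h₂ => ?_, fun n₁ n₂ n₃ => ?_, fun n₁ n₂ n₃ => ?_,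
      fun n₁ n₂ n₃ n₄ p₁ p₂ p₃ p₄ hp => ?_⟩
    · rw [(h _ _ _ _).1, GradedStar.finrank_unitSpan_zero]
    · obtain ⟨n, rfl⟩ := Nat.exists_eq_succ_of_ne_zero (Nat.one_le_iff_ne_zero.1 h₂)
      rw [(h _ _ _ _).1, GradedStar.finrank_unitSpan_diag]
    · rw [(h _ _ _ _).1, GradedStar.finrank_unitSpan_succ_left]
    · rw [(h _ _ _ _).1, GradedStar.finrank_unitSpan_succ_right]
    · by_cases hp' : p₁ = GradedStar.oneRow n₁ ∧ p₂ = GradedStar.oneColumn n₂ ∧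
          p₃ = GradedStar.oneRow n₃ ∧ p₄ = GradedStar.oneColumn n₄
      · obtain ⟨rfl, rfl, rfl, rfl⟩ := hp'
        rw [(h _ _ _ _).1, GradedStar.finrank_unitSpan_eq_zero]
        exact fun hn => hp ⟨rfl, rfl, rfl, rfl, hn⟩
      · exact (h _ _ _ _).2 _ _ _ _ hp'
  · rintro ⟨h₁, h₂, h₃, h₄, h₅⟩ n₁ n₂ n₃ n₄
    refine ⟨?_, fun p₁ p₂ p₃ p₄ hp =>
      h₅ _ _ _ _ _ _ _ _ fun h => hp ⟨h.1, h.2.1, h.2.2.1, h.2.2.2.1⟩⟩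
    by_cases hn : n₂ = n₄ ∨ n₂ = n₄ + 1 ∨ n₄ = n₂ + 1
    · rcases hn with rfl | rfl | rfl
      · rcases n₂ with _ | n
        · rw [h₁, GradedStar.finrank_unitSpan_zero]
        · rw [h₂ _ _ _ (Nat.le_add_left 1 n), GradedStar.finrank_unitSpan_diag]
      · rw [h₃, GradedStar.finrank_unitSpan_succ_left]
      · rw [h₄, GradedStar.finrank_unitSpan_succ_right]
    · rw [GradedStar.finrank_unitSpan_eq_zero _ _ hn]
      exact h₅ _ _ _ _ _ _ _ _ fun h => hn h.2.2.2.2
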